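/- \textbf{Conventions.} For a complex vector space $V$, $M_n(V)$ denotes the $n\times n$ matrices over $V$; $M_n=M_n(\mathbb C)$ and scalar matrices carry the operator norm. A \emph{matrix ordered operator space} is an operator space $V$ (norms $\|\cdot\|_n$ on the spaces $M_n(V)$ satisfying Ruan's axioms) with a conjugate-linear involution $*$ and, for each $n\in\mathbb N$, a (not necessarily proper) cone $M_n(V)^+\subset M_n(V)_{sa}$, such that $\alpha^*M_m(V)^+\alpha\subset M_n(V)^+$ for every $\alpha\in M_{m,n}$, the involution $[x_{ij}]\mapsto[x_{ji}^*]$ is isometric on $M_n(V)$, and $M_n(V)^+$ is norm closed. Its dual $V^*$ is the matrix ordered operator space with involution $f^*(v)=\overline{f(v^*)}$, norms given by $M_n(V^*)=CB(V,M_n)$, and cones $M_n(V^*)^+=CB(V,M_n)\cap CP(V,M_n)$ (completely bounded, self-adjoint and completely positive maps). A matrix ordered operator space $X$ is an \emph{operator system} (in the sense of Werner) if all cones $M_n(X)^+$ are proper and there is a constant $k>0$ such that $\|x\|_n\le k\,\nu_X(x)$ for all $n\in\mathbb N$ and $x\in M_n(X)$, where $$\nu_X(x)=\sup\Big\{\Big|\varphi\begin{pmatrix}0&x\\x^*&0\end{pmatrix}\Big|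 : \varphi\in M_{2n}(X)^*,\ \varphi\ge0,\ \|\varphi\|\le1\Big\}.$$ A matrix ordered operator space $W$ with complete norm is \emph{matrix regular} if for all $n\in\mathbb N$ and $v\in M_n(W)_{sa}$: (1) $u\in M_n(W)^+$ and $-u\le v\le u$ imply $\|v\|_n\le\|u\|_n$; (2) if $\|v\|_n<1$ then there is $u\in M_n(W)^+$ with $\|u\|_n<1$ and $-u\le v\le u$. \textbf{Theorem.} Let $V$ be a matrix ordered operator space with complete norm. Suppose that both $V$ and its dual space $V^*$ are operator systems. Then $V$ is completely isomorphic and complete order isomorphic to a matrix regular operator space: there are a matrix regular operator space $W$ and a single linear bijection $\Phi:V\to W$ such that $\Phi$ and $\Phi^{-1}$ are completely bounded, $\Phi(v^*)=\Phi(v)^*$ for all $v\in V$, and for all $n\in\mathbb N$ and $x\in M_n(V)$, $x\in M_n(V)^+$ if and only if $\Phi_n(x)\in M_n(W)^+$. -/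

import Mathlib

universe u

noncomputable section

namespace OpSys

set_option linter.unusedSectionVars false
set_option linter.unusedSimpArgs false

open scoped Matrix.Norms.L2Operator ComplexOrder Matrix Kronecker

/-- `M_n(V)`. -/
abbrev Mat (n : ℕ) (V : Type*) : Type _ := Matrix (Fin n) (Fin n) V

/-- The product `α x β` of a matrix `x` over a complex vector space with scalar matrices. -/
def bimul {V : Type*} [AddCommGroup V] [Module ℂ V] {m n : ℕ}
    (α : Matrix (Fin n) (Fin m) ℂ) (x : Mat m V) (β : Matrix (Fin m) (Fin n) ℂ) : Mat n V :=
  Matrix.of fun i j => ∑ a, ∑ b, (α i a * β b j) • x a b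

/-- The block matrix `[a b; c d]` in `M_{m+n}(V)`. -/
def block {V : Type*} {m n : ℕ} (a : Mat m V) (b : Matrix (Fin m) (Fin n) V)
    (c : Matrix (Fin n) (Fin m) V) (d : Mat n V) : Mat (m + n) V :=
  (Matrix.fromBlocks a b c d).reindex finSumFinEquiv finSumFinEquiv

/-- An (abstract) operator space structure on `V`, by Ruan's axioms: a norm on every `M_n(V)`,
which for `n = 1` is the norm of `V`, with `‖x ⊕ y‖ = max ‖x‖ ‖y‖` and
`‖α x β‖ ≤ ‖α‖ ‖x‖ ‖β‖`, the scalar matrices carrying the operator norm on Euclidean space. -/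
class OperatorSpace (V : Type*) [NormedAddCommGroup V] [NormedSpace ℂ V] where
  mnorm : ∀ n : ℕ, Mat n V → ℝ
  mnorm_one : ∀ v : V, mnorm 1 (Matrix.of fun _ _ => v) = ‖v‖
  mnorm_add_le : ∀ (n : ℕ) (x y : Mat n V), mnorm n (x + y) ≤ mnorm n x + mnorm n y
  mnorm_smul : ∀ (n : ℕ) (c : ℂ) (x : Mat n V), mnorm n (c • x) = ‖c‖ * mnorm n x
  eq_zero_of_mnorm : ∀ (n : ℕ) (x : Mat n V), mnorm n x = 0 → x = 0
  mnorm_block : ∀ (m n : ℕ) (x : Mat m V) (y : Mat n V),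
    mnorm (m + n) (block x 0 0 y) = max (mnorm m x) (mnorm n y)
  mnorm_bimul_le : ∀ (m n : ℕ) (α : Matrix (Fin n) (Fin m) ℂ) (x : Mat m V)
    (β : Matrix (Fin m) (Fin n) ℂ), mnorm n (bimul α x β) ≤ ‖α‖ * mnorm m x * ‖β‖

/-- A matrix ordered complex `*`-vector space: (not necessarily proper) cones
`M_n(V)^+ ⊆ M_n(V)_sa`, compatible with scalar compressions. -/
class MatrixOrdered (V : Type*) [AddCommGroup V] [Module ℂ V] [StarAddMonoid V]
    [StarModule ℂ V] where
  cone : ∀ n : ℕ, Set (Mat n V)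
  cone_isHermitian : ∀ (n : ℕ) (x : Mat n V), x ∈ cone n → x.IsHermitian
  cone_zero : ∀ n : ℕ, (0 : Mat n V) ∈ cone n
  cone_add : ∀ (n : ℕ) (x y : Mat n V), x ∈ cone n → y ∈ cone n → x + y ∈ cone n
  cone_smul : ∀ (n : ℕ) (r : ℝ) (x : Mat n V), 0 ≤ r → x ∈ cone n → (r : ℂ) • x ∈ cone n
  cone_bimul : ∀ (m n : ℕ) (α : Matrix (Fin m) (Fin n) ℂ) (x : Mat m V),
    x ∈ cone m → bimul αᴴ x α ∈ cone n

/-- A matrix ordered operator space: the involution is isometric on every `M_n(V)` and the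
cones `M_n(V)^+` are norm closed. -/
class MatrixOrderedOperatorSpace (V : Type*) [NormedAddCommGroup V] [NormedSpace ℂ V]
    [StarAddMonoid V] [StarModule ℂ V] extends OperatorSpace V, MatrixOrdered V where
  mnorm_conjTranspose : ∀ (n : ℕ) (x : Mat n V), mnorm n xᴴ = mnorm n x
  cone_closed : ∀ (n : ℕ) (x : Mat n V),
    (∀ ε : ℝ, 0 < ε → ∃ y ∈ cone n, mnorm n (x - y) < ε) → x ∈ cone n

/-! ### Euclidean operator norms of scalar matrices -/

section Scalar

variable {κ ι : Type*} [Fintype κ] [DecidableEq κ] [Fintype ι] [DecidableEq ι]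

theorem form_eq_inner (A : Matrix κ ι ℂ) (η : EuclideanSpace ℂ κ) (ξ : EuclideanSpace ℂ ι) :
    ∑ p, ∑ q, star (η p) * A p q * ξ q
      = inner ℂ η ((EuclideanSpace.equiv κ ℂ).symm (A *ᵥ ξ)) := by
  simp only [PiLp.inner_apply, RCLike.inner_apply]
  refine Finset.sum_congr rfl fun p _ => ?_
  simp only [mul_assoc, ← Finset.mul_sum]
  simp [Matrix.mulVec, dotProduct, mul_comm]

theorem norm_form_le (A : Matrix κ ι ℂ) (η : EuclideanSpace ℂ κ) (ξ : EuclideanSpace ℂ ι) :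
    ‖∑ p, ∑ q, star (η p) * A p q * ξ q‖ ≤ ‖A‖ * ‖η‖ * ‖ξ‖ := by
  rw [form_eq_inner]
  refine (norm_inner_le_norm _ _).trans ?_
  have := Matrix.l2_opNorm_mulVec A ξ
  nlinarith [norm_nonneg η]

theorem opNorm_le_of_form (A : Matrix κ ι ℂ) {C : ℝ} (hC : 0 ≤ C)
    (h : ∀ (η : EuclideanSpace ℂ κ) (ξ : EuclideanSpace ℂ ι),
      ‖∑ p, ∑ q, star (η p) * A p q * ξ q‖ ≤ C * ‖η‖ * ‖ξ‖) : ‖A‖ ≤ C := by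
  rw [Matrix.l2_opNorm_def]
  refine ContinuousLinearMap.opNorm_le_bound _ hC fun ξ => ?_
  change ‖(EuclideanSpace.equiv κ ℂ).symm (A *ᵥ ξ)‖ ≤ _
  set w := (EuclideanSpace.equiv κ ℂ).symm (A *ᵥ ξ) with hw
  have h1 := h w ξ
  rw [form_eq_inner, ← hw, inner_self_eq_norm_sq_to_K] at h1
  have h2 : ‖w‖ * ‖w‖ ≤ (C * ‖ξ‖) * ‖w‖ := by
    have : ‖((‖w‖ : ℂ)) ^ 2‖ = ‖w‖ * ‖w‖ := by
      rw [norm_pow, Complex.norm_real, norm_norm, sq]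
    calc ‖w‖ * ‖w‖ = ‖((‖w‖ : ℂ)) ^ 2‖ := this.symm
      _ ≤ C * ‖w‖ * ‖ξ‖ := h1
      _ = _ := by ring
  rcases (norm_nonneg w).eq_or_lt with h0 | h0
  · rw [← h0]; positivity
  · exact le_of_mul_le_mul_right h2 h0

theorem norm_entry_le (A : Matrix κ ι ℂ) (p : κ) (q : ι) : ‖A p q‖ ≤ ‖A‖ := by
  have h := norm_form_le A (EuclideanSpace.single p 1) (EuclideanSpace.single q 1)
  have h2 : ∑ p', ∑ q', star ((EuclideanSpace.single p (1 : ℂ)) p') * A p' q'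
      * (EuclideanSpace.single q (1 : ℂ)) q' = A p q := by
    rw [Finset.sum_eq_single p, Finset.sum_eq_single q] <;> simp +contextual
  rw [h2] at h
  simpa using h

theorem norm_row_le (u : EuclideanSpace ℂ ι) :
    ‖(Matrix.of fun (_ : Fin 1) a => star (u a) : Matrix (Fin 1) ι ℂ)‖ ≤ ‖u‖ := by
  refine opNorm_le_of_form _ (norm_nonneg _) fun η ξ => ?_
  have h : ∑ p, ∑ q, star (η p) * (Matrix.of fun (_ : Fin 1) a => star (u a)) p q * ξ q
      = star (η 0) * inner ℂ u ξ := by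
    simp [PiLp.inner_apply, Finset.mul_sum, mul_comm, mul_assoc, mul_left_comm]
  rw [h, norm_mul, norm_star]
  have h1 := norm_inner_le_norm (𝕜 := ℂ) u ξ
  have h2 : ‖η 0‖ ≤ ‖η‖ := PiLp.norm_apply_le η 0
  calc ‖η 0‖ * ‖(inner ℂ u ξ : ℂ)‖ ≤ ‖η‖ * (‖u‖ * ‖ξ‖) := by gcongr
    _ = _ := by ring

theorem norm_col_le (u : EuclideanSpace ℂ ι) :
    ‖(Matrix.of fun a (_ : Fin 1) => u a : Matrix ι (Fin 1) ℂ)‖ ≤ ‖u‖ := by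
  have h := norm_row_le u
  rw [← Matrix.l2_opNorm_conjTranspose] at h
  convert h using 2
  ext i j
  simp

theorem norm_one_kronecker_le {l : ℕ} (α : Matrix κ ι ℂ) :
    ‖((1 : Matrix (Fin l) (Fin l) ℂ) ⊗ₖ α)‖ ≤ ‖α‖ := by
  refine opNorm_le_of_form _ (norm_nonneg _) fun η ξ => ?_
  set e : Fin l → EuclideanSpace ℂ κ := fun c => WithLp.toLp 2 fun k => η (c, k) with he
  set f : Fin l → EuclideanSpace ℂ ι := fun c => WithLp.toLp 2 fun k => ξ (c, k) with hf
  have h : ∑ p, ∑ q, star (η p) * ((1 : Matrix (Fin l) (Fin l) ℂ) ⊗ₖ α) p q * ξ q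
      = ∑ c, ∑ p, ∑ q, star (e c p) * α p q * f c q := by
    simp [Fintype.sum_prod_type, Matrix.one_apply, he, hf]
  have hη : ‖η‖ ^ 2 = ∑ c, ‖e c‖ ^ 2 := by
    simp [EuclideanSpace.norm_sq_eq, Fintype.sum_prod_type, he]
  have hξ : ‖ξ‖ ^ 2 = ∑ c, ‖f c‖ ^ 2 := by
    simp [EuclideanSpace.norm_sq_eq, Fintype.sum_prod_type, hf]
  have hcs : ∑ c, ‖e c‖ * ‖f c‖ ≤ ‖η‖ * ‖ξ‖ := by
    refine abs_le_of_sq_le_sq' ?_ (by positivity) |>.2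
    rw [mul_pow, hη, hξ]
    exact Finset.sum_mul_sq_le_sq_mul_sq _ _ _
  rw [h]
  calc _ ≤ ∑ c, ‖α‖ * ‖e c‖ * ‖f c‖ :=
        (norm_sum_le _ _).trans (Finset.sum_le_sum fun c _ => norm_form_le α (e c) (f c))
    _ = ‖α‖ * ∑ c, ‖e c‖ * ‖f c‖ := by simp [Finset.mul_sum, mul_assoc]
    _ ≤ ‖α‖ * (‖η‖ * ‖ξ‖) := by gcongr
    _ = _ := by ring

end Scalar

/-! ### The dual of a matrix ordered operator space -/

section Dual

variable {V : Type*} [NormedAddCommGroup V] [NormedSpace ℂ V]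

/-- For `F = [f_ij]` in `M_n(V^*)`, viewed as the map `v ↦ [f_ij(v)]` from `V` to `M_n`, the
value `F_m(x)` in `M_m(M_n)` of its `m`-th amplification at `x` in `M_m(V)`. -/
def ampl {n m : ℕ} (F : Mat n (StrongDual ℂ V)) (x : Mat m V) :
    Matrix (Fin m × Fin n) (Fin m × Fin n) ℂ :=
  Matrix.of fun p q => F p.2 q.2 (x p.1 q.1)

/-- The norm of `M_n(V^*) = CB(V, M_n)`: the completely bounded norm. -/
def dualNorm [OperatorSpace V] {n : ℕ} (F : Mat n (StrongDual ℂ V)) : ℝ :=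
  sSup {r : ℝ | ∃ (m : ℕ) (x : Mat m V), OperatorSpace.mnorm m x ≤ 1 ∧ r = ‖ampl F x‖}

section Norm

variable [OperatorSpace V]

open OperatorSpace

theorem mnorm_zero (n : ℕ) : mnorm n (0 : Mat n V) = 0 := by
  simpa using mnorm_smul n (0 : ℂ) (0 : Mat n V)

theorem mnorm_nonneg (n : ℕ) (x : Mat n V) : 0 ≤ mnorm n x := by
  have h1 := mnorm_add_le n x ((-1 : ℂ) • x)
  rw [mnorm_smul] at h1
  simp [mnorm_zero] at h1
  exact h1

theorem norm_ampl_le_aux {n m : ℕ} (F : Mat n (StrongDual ℂ V)) (x : Mat m V) :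
    ‖ampl F x‖ ≤ (∑ i, ∑ j, ‖F i j‖) * mnorm m x := by
  have hx := mnorm_nonneg m x
  refine opNorm_le_of_form _ (by positivity) fun η ξ => ?_
  set e : Fin n → EuclideanSpace ℂ (Fin m) := fun i => WithLp.toLp 2 fun a => η (a, i) with he
  set f : Fin n → EuclideanSpace ℂ (Fin m) := fun i => WithLp.toLp 2 fun a => ξ (a, i) with hf
  have hen : ∀ i, ‖e i‖ ≤ ‖η‖ := fun i => by
    refine abs_le_of_sq_le_sq' ?_ (by positivity) |>.2
    simp only [EuclideanSpace.norm_sq_eq, Fintype.sum_prod_type, he]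
    refine Finset.sum_le_sum fun a _ => ?_
    exact Finset.single_le_sum (f := fun i => ‖η (a, i)‖ ^ 2) (fun _ _ => by positivity)
      (Finset.mem_univ i)
  have hfn : ∀ i, ‖f i‖ ≤ ‖ξ‖ := fun i => by
    refine abs_le_of_sq_le_sq' ?_ (by positivity) |>.2
    simp only [EuclideanSpace.norm_sq_eq, Fintype.sum_prod_type, hf]
    refine Finset.sum_le_sum fun a _ => ?_
    exact Finset.single_le_sum (f := fun i => ‖ξ (a, i)‖ ^ 2) (fun _ _ => by positivity)
      (Finset.mem_univ i)
  set s : Fin n → Fin n → V := fun i j => ∑ a, ∑ b, (star (e i a) * f j b) • x a b with hs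
  have hsn : ∀ i j, ‖s i j‖ ≤ ‖η‖ * mnorm m x * ‖ξ‖ := fun i j => by
    have h1 := mnorm_bimul_le m 1 (Matrix.of fun (_ : Fin 1) a => star (e i a)) x
      (Matrix.of fun a (_ : Fin 1) => f j a)
    have h2 : bimul (Matrix.of fun (_ : Fin 1) a => star (e i a)) x
      (Matrix.of fun a (_ : Fin 1) => f j a) = Matrix.of fun _ _ => s i j := by
      ext p q; simp [bimul, hs]
    rw [h2, mnorm_one] at h1
    refine h1.trans ?_
    have h3 := (norm_row_le (e i)).trans (hen i)
    have h4 := (norm_col_le (f j)).trans (hfn j)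
    gcongr
  have h : ∑ p, ∑ q, star (η p) * ampl F x p q * ξ q = ∑ i, ∑ j, F i j (s i j) := by
    simp only [Fintype.sum_prod_type, ampl, Matrix.of_apply, hs, map_sum, map_smul, he, hf,
      smul_eq_mul]
    rw [Finset.sum_comm]
    refine Finset.sum_congr rfl fun i _ => ?_
    rw [Finset.sum_comm' (t' := Finset.univ) (s' := fun _ => Finset.univ) (by simp)]
    conv_rhs => rw [Finset.sum_comm]
    rw [Finset.sum_comm]
    refine Finset.sum_congr rfl fun a _ => ?_
    rw [Finset.sum_comm]
    refine Finset.sum_congr rfl fun j _ => Finset.sum_congr rfl fun b _ => ?_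
    ring
  rw [h]
  calc _ ≤ ∑ i, ∑ j, ‖F i j‖ * (‖η‖ * mnorm m x * ‖ξ‖) := by
        refine (norm_sum_le _ _).trans (Finset.sum_le_sum fun i _ => ?_)
        refine (norm_sum_le _ _).trans (Finset.sum_le_sum fun j _ => ?_)
        exact ((F i j).le_opNorm _).trans (by gcongr; exact hsn i j)
    _ = _ := by simp only [← Finset.sum_mul]; ring

theorem dualNorm_bddAbove {n : ℕ} (F : Mat n (StrongDual ℂ V)) :
    BddAbove {r : ℝ | ∃ (m : ℕ) (x : Mat m V), mnorm m x ≤ 1 ∧ r = ‖ampl F x‖} := by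
  refine ⟨∑ i, ∑ j, ‖F i j‖, ?_⟩
  rintro r ⟨m, x, hx, rfl⟩
  refine (norm_ampl_le_aux F x).trans (mul_le_of_le_one_right (by positivity) hx)

theorem dualNorm_nonneg {n : ℕ} (F : Mat n (StrongDual ℂ V)) : 0 ≤ dualNorm F := by
  refine Real.sSup_nonneg ?_
  rintro r ⟨m, x, hx, rfl⟩
  exact norm_nonneg _

theorem ampl_smul_right {n m : ℕ} (F : Mat n (StrongDual ℂ V)) (c : ℂ) (x : Mat m V) :
    ampl F (c • x) = c • ampl F x := by
  ext p q; simp [ampl]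

theorem norm_ampl_le {n m : ℕ} (F : Mat n (StrongDual ℂ V)) (x : Mat m V) :
    ‖ampl F x‖ ≤ dualNorm F * mnorm m x := by
  rcases (mnorm_nonneg m x).eq_or_lt with h0 | h0
  · have : x = 0 := eq_zero_of_mnorm m x h0.symm
    subst this
    have : ampl F (0 : Mat m V) = 0 := by ext p q; simp [ampl]
    rw [this, norm_zero, ← h0, mul_zero]
  · have h1 : ‖ampl F (((mnorm m x)⁻¹ : ℂ) • x)‖ ≤ dualNorm F := by
      refine le_csSup (dualNorm_bddAbove F) ⟨m, _, ?_, rfl⟩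
      rw [mnorm_smul, norm_inv, Complex.norm_real, Real.norm_of_nonneg h0.le,
        inv_mul_cancel₀ h0.ne']
    rw [ampl_smul_right, norm_smul, norm_inv, Complex.norm_real, Real.norm_of_nonneg h0.le] at h1
    rwa [inv_mul_le_iff₀ h0, mul_comm] at h1

theorem dualNorm_le {n : ℕ} (F : Mat n (StrongDual ℂ V)) {C : ℝ} (hC : 0 ≤ C)
    (h : ∀ (m : ℕ) (x : Mat m V), ‖ampl F x‖ ≤ C * mnorm m x) : dualNorm F ≤ C := by
  refine Real.sSup_le ?_ hC
  rintro r ⟨m, x, hx, rfl⟩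
  exact (h m x).trans (mul_le_of_le_one_right hC hx)

theorem dualNorm_one (f : StrongDual ℂ V) :
    dualNorm (Matrix.of fun (_ _ : Fin 1) => f) = ‖f‖ := by
  refine le_antisymm (dualNorm_le _ (norm_nonneg _) fun m x => ?_)
    (f.opNorm_le_bound (dualNorm_nonneg _) fun v => ?_)
  · simpa using norm_ampl_le_aux (Matrix.of fun (_ _ : Fin 1) => f) x
  · have h1 := norm_ampl_le (Matrix.of fun (_ _ : Fin 1) => f) (Matrix.of fun (_ _ : Fin 1) => v)
    rw [mnorm_one] at h1
    exact (norm_entry_le _ (0, 0) (0, 0)).trans h1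

theorem ampl_add {n m : ℕ} (F G : Mat n (StrongDual ℂ V)) (x : Mat m V) :
    ampl (F + G) x = ampl F x + ampl G x := by
  ext p q; simp [ampl]

theorem ampl_smul {n m : ℕ} (c : ℂ) (F : Mat n (StrongDual ℂ V)) (x : Mat m V) :
    ampl (c • F) x = c • ampl F x := by
  ext p q; simp [ampl]

theorem ampl_bimul {k n m : ℕ} (α : Matrix (Fin n) (Fin k) ℂ) (F : Mat k (StrongDual ℂ V))
    (β : Matrix (Fin k) (Fin n) ℂ) (x : Mat m V) :
    ampl (bimul α F β) x
      = ((1 : Matrix (Fin m) (Fin m) ℂ) ⊗ₖ α) * ampl F x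
        * ((1 : Matrix (Fin m) (Fin m) ℂ) ⊗ₖ β) := by
  ext ⟨a, i⟩ ⟨b, j⟩
  simp only [ampl, bimul, Matrix.mul_apply, Matrix.of_apply, Fintype.sum_prod_type,
    Matrix.kroneckerMap_apply, Matrix.one_apply, ite_mul, one_mul, zero_mul, mul_ite, mul_zero,
    Finset.sum_ite_irrel, Finset.sum_const_zero, Finset.sum_ite_eq, Finset.sum_ite_eq',
    Finset.mem_univ, if_true, Finset.sum_mul, sum_apply,
    smul_apply, smul_eq_mul]
  rw [Finset.sum_comm]
  refine Finset.sum_congr rfl fun c _ => Finset.sum_congr rfl fun d _ => ?_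
  ring

theorem dualNorm_add_le {n : ℕ} (F G : Mat n (StrongDual ℂ V)) :
    dualNorm (F + G) ≤ dualNorm F + dualNorm G := by
  refine dualNorm_le _ (add_nonneg (dualNorm_nonneg _) (dualNorm_nonneg _)) fun m x => ?_
  rw [ampl_add, add_mul]
  exact (norm_add_le _ _).trans (add_le_add (norm_ampl_le F x) (norm_ampl_le G x))

theorem dualNorm_smul_le {n : ℕ} (c : ℂ) (F : Mat n (StrongDual ℂ V)) :
    dualNorm (c • F) ≤ ‖c‖ * dualNorm F := by
  refine dualNorm_le _ (mul_nonneg (norm_nonneg _) (dualNorm_nonneg _)) fun m x => ?_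
  rw [ampl_smul, norm_smul, mul_assoc]
  exact mul_le_mul_of_nonneg_left (norm_ampl_le F x) (norm_nonneg _)

theorem dualNorm_smul {n : ℕ} (c : ℂ) (F : Mat n (StrongDual ℂ V)) :
    dualNorm (c • F) = ‖c‖ * dualNorm F := by
  refine le_antisymm (dualNorm_smul_le c F) ?_
  rcases eq_or_ne c 0 with rfl | hc
  · simpa using dualNorm_nonneg _
  · have h := dualNorm_smul_le c⁻¹ (c • F)
    rw [smul_smul, inv_mul_cancel₀ hc, one_smul, norm_inv] at h
    rwa [le_inv_mul_iff₀ (norm_pos_iff.2 hc)] at h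

theorem eq_zero_of_dualNorm {n : ℕ} (F : Mat n (StrongDual ℂ V)) (h : dualNorm F = 0) :
    F = 0 := by
  ext i j v
  have h1 := norm_ampl_le F (Matrix.of fun (_ _ : Fin 1) => v)
  rw [h, zero_mul] at h1
  have h2 := (norm_entry_le _ (0, i) (0, j)).trans h1
  simpa [ampl] using h2

theorem dualNorm_bimul_le {m n : ℕ} (α : Matrix (Fin n) (Fin m) ℂ) (F : Mat m (StrongDual ℂ V))
    (β : Matrix (Fin m) (Fin n) ℂ) :
    dualNorm (bimul α F β) ≤ ‖α‖ * dualNorm F * ‖β‖ := by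
  have hF := dualNorm_nonneg F
  refine dualNorm_le _ (by positivity) fun l x => ?_
  rw [ampl_bimul]
  have hx := mnorm_nonneg l x
  calc _ ≤ ‖(1 : Matrix (Fin l) (Fin l) ℂ) ⊗ₖ α‖ * ‖ampl F x‖
          * ‖(1 : Matrix (Fin l) (Fin l) ℂ) ⊗ₖ β‖ :=
        (Matrix.l2_opNorm_mul _ _).trans
          (mul_le_mul_of_nonneg_right (Matrix.l2_opNorm_mul _ _) (norm_nonneg _))
    _ ≤ ‖α‖ * (dualNorm F * mnorm l x) * ‖β‖ := by
        have h1 := norm_one_kronecker_le (l := l) α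
        have h2 := norm_one_kronecker_le (l := l) β
        have h3 := norm_ampl_le F x
        gcongr
    _ = _ := by ring

theorem dualNorm_block_le {m n : ℕ} (F : Mat m (StrongDual ℂ V)) (G : Mat n (StrongDual ℂ V)) :
    dualNorm (block F 0 0 G) ≤ max (dualNorm F) (dualNorm G) := by
  have h0 : 0 ≤ max (dualNorm F) (dualNorm G) := le_max_of_le_left (dualNorm_nonneg F)
  refine dualNorm_le _ h0 fun l x => ?_
  have hx := mnorm_nonneg l x
  refine opNorm_le_of_form _ (by positivity) fun η ξ => ?_
  set e1 : EuclideanSpace ℂ (Fin l × Fin m) :=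
    WithLp.toLp 2 fun p => η (p.1, Fin.castAdd n p.2) with he1
  set e2 : EuclideanSpace ℂ (Fin l × Fin n) :=
    WithLp.toLp 2 fun p => η (p.1, Fin.natAdd m p.2) with he2
  set f1 : EuclideanSpace ℂ (Fin l × Fin m) :=
    WithLp.toLp 2 fun p => ξ (p.1, Fin.castAdd n p.2) with hf1
  set f2 : EuclideanSpace ℂ (Fin l × Fin n) :=
    WithLp.toLp 2 fun p => ξ (p.1, Fin.natAdd m p.2) with hf2
  have h : ∑ p, ∑ q, star (η p) * ampl (block F 0 0 G) x p q * ξ q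
      = (∑ p, ∑ q, star (e1 p) * ampl F x p q * f1 q)
        + ∑ p, ∑ q, star (e2 p) * ampl G x p q * f2 q := by
    simp [Fintype.sum_prod_type, Fin.sum_univ_add, ampl, block, he1, he2, hf1, hf2,
      Finset.sum_add_distrib]
  have hη : ‖η‖ ^ 2 = ‖e1‖ ^ 2 + ‖e2‖ ^ 2 := by
    simp [EuclideanSpace.norm_sq_eq, Fintype.sum_prod_type, he1, he2, Fin.sum_univ_add,
      Finset.sum_add_distrib]
  have hξ : ‖ξ‖ ^ 2 = ‖f1‖ ^ 2 + ‖f2‖ ^ 2 := by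
    simp [EuclideanSpace.norm_sq_eq, Fintype.sum_prod_type, hf1, hf2, Fin.sum_univ_add,
      Finset.sum_add_distrib]
  have hcs : ‖e1‖ * ‖f1‖ + ‖e2‖ * ‖f2‖ ≤ ‖η‖ * ‖ξ‖ := by
    refine abs_le_of_sq_le_sq' ?_ (by positivity) |>.2
    rw [mul_pow, hη, hξ]
    nlinarith [sq_nonneg (‖e1‖ * ‖f2‖ - ‖e2‖ * ‖f1‖)]
  have hF : ‖ampl F x‖ ≤ max (dualNorm F) (dualNorm G) * mnorm l x :=
    (norm_ampl_le F x).trans (mul_le_mul_of_nonneg_right (le_max_left _ _) hx)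
  have hG : ‖ampl G x‖ ≤ max (dualNorm F) (dualNorm G) * mnorm l x :=
    (norm_ampl_le G x).trans (mul_le_mul_of_nonneg_right (le_max_right _ _) hx)
  rw [h]
  set D := max (dualNorm F) (dualNorm G) * mnorm l x with hD
  calc _ ≤ ‖ampl F x‖ * ‖e1‖ * ‖f1‖ + ‖ampl G x‖ * ‖e2‖ * ‖f2‖ :=
        (norm_add_le _ _).trans (add_le_add (norm_form_le _ _ _) (norm_form_le _ _ _))
    _ ≤ D * ‖e1‖ * ‖f1‖ + D * ‖e2‖ * ‖f2‖ := by gcongr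
    _ = D * (‖e1‖ * ‖f1‖ + ‖e2‖ * ‖f2‖) := by ring
    _ ≤ D * (‖η‖ * ‖ξ‖) := mul_le_mul_of_nonneg_left hcs (by positivity)
    _ = _ := by ring

theorem dualNorm_le_of_submatrix {k n : ℕ} (F : Mat k (StrongDual ℂ V)) (s : Fin n → Fin k)
    (hs : Function.Injective s) : dualNorm (F.submatrix s s) ≤ dualNorm F := by
  have hF := dualNorm_nonneg F
  refine dualNorm_le _ hF fun l x => ?_
  have hx := mnorm_nonneg l x
  have key : ∀ A : Matrix (Fin l × Fin k) (Fin l × Fin k) ℂ,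
      ‖A.submatrix (Prod.map id s) (Prod.map id s)‖ ≤ ‖A‖ := by
    intro A
    have ht : Function.Injective (Prod.map (id : Fin l → Fin l) s) :=
      Function.injective_id.prodMap hs
    set t := Prod.map (id : Fin l → Fin l) s
    refine opNorm_le_of_form _ (norm_nonneg _) fun η ξ => ?_
    set E : EuclideanSpace ℂ (Fin l × Fin n) → EuclideanSpace ℂ (Fin l × Fin k) :=
      fun η => WithLp.toLp 2 (Function.extend t η 0) with hE
    have sumE : ∀ (η : EuclideanSpace ℂ (Fin l × Fin n)) (g : Fin l × Fin k → ℂ → ℝ),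
        (∀ p, g p 0 = 0) → ∑ p, g p (E η p) = ∑ q, g (t q) (η q) := by
      intro η g hg
      rw [← Finset.sum_subset (Finset.subset_univ (Finset.univ.image t)),
        Finset.sum_image fun a _ b _ h => ht h]
      · exact Finset.sum_congr rfl fun q _ => by simp [hE, ht.extend_apply]
      · intro p _ hp
        have : ¬ ∃ q, t q = p := by simpa using hp
        simp [hE, Function.extend_apply' _ _ _ this, hg]
    have sumE' : ∀ (η : EuclideanSpace ℂ (Fin l × Fin n)) (g : Fin l × Fin k → ℂ → ℂ),
        (∀ p, g p 0 = 0) → ∑ p, g p (E η p) = ∑ q, g (t q) (η q) := by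
      intro η g hg
      rw [← Finset.sum_subset (Finset.subset_univ (Finset.univ.image t)),
        Finset.sum_image fun a _ b _ h => ht h]
      · exact Finset.sum_congr rfl fun q _ => by simp [hE, ht.extend_apply]
      · intro p _ hp
        have : ¬ ∃ q, t q = p := by simpa using hp
        simp [hE, Function.extend_apply' _ _ _ this, hg]
    have nE : ∀ η, ‖E η‖ = ‖η‖ := by
      intro η
      rw [EuclideanSpace.norm_eq, EuclideanSpace.norm_eq, sumE η (fun _ z => ‖z‖ ^ 2) (by simp)]
    have h := norm_form_le A (E η) (E ξ)
    rw [nE, nE, sumE' η (fun p z => ∑ q, star z * A p q * (E ξ) q) (by simp)] at h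
    have h' : ∑ p, ∑ q, star (η p) * A.submatrix t t p q * ξ q
        = ∑ p, ∑ q, star (η p) * A (t p) q * (E ξ) q :=
      Finset.sum_congr rfl fun p _ =>
        (sumE' ξ (fun q z => star (η p) * A (t p) q * z) (by simp)).symm
    rw [h']
    exact h
  exact (key (ampl F x)).trans (norm_ampl_le F x)

theorem dualNorm_block {m n : ℕ} (F : Mat m (StrongDual ℂ V)) (G : Mat n (StrongDual ℂ V)) :
    dualNorm (block F 0 0 G) = max (dualNorm F) (dualNorm G) := by
  refine le_antisymm (dualNorm_block_le F G) (max_le ?_ ?_)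
  · have h := dualNorm_le_of_submatrix (block F 0 0 G) (Fin.castAdd n) (Fin.castAdd_injective m n)
    have hs : (block F 0 0 G).submatrix (Fin.castAdd n) (Fin.castAdd n) = F := by
      ext i j v; simp [block]
    rwa [hs] at h
  · have h := dualNorm_le_of_submatrix (block F 0 0 G) (Fin.natAdd m) (Fin.natAdd_injective n m)
    have hs : (block F 0 0 G).submatrix (Fin.natAdd m) (Fin.natAdd m) = G := by
      ext i j v; simp [block]
    rwa [hs] at h

/-- The operator space dual, `M_n(V^*) = CB(V, M_n)`. -/
instance : OperatorSpace (StrongDual ℂ V) where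
  mnorm _ F := dualNorm F
  mnorm_one := dualNorm_one
  mnorm_add_le _ := dualNorm_add_le
  mnorm_smul _ := dualNorm_smul
  eq_zero_of_mnorm _ := eq_zero_of_dualNorm
  mnorm_block _ _ := dualNorm_block
  mnorm_bimul_le _ _ := dualNorm_bimul_le

end Norm

section Star

variable [StarAddMonoid V] [NormedStarGroup V] [StarModule ℂ V]

/-- The involution `f^*(v) = conj (f (v^*))` of the dual space. -/
instance : Star (StrongDual ℂ V) where
  star f := LinearMap.mkContinuous
    { toFun := fun v => star (f (star v))
      map_add' := by simp
      map_smul' := by simp } ‖f‖ fun v => by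
        simpa using f.le_opNorm (star v)

theorem star_dual_apply (f : StrongDual ℂ V) (v : V) : (star f) v = star (f (star v)) := rfl

instance : StarAddMonoid (StrongDual ℂ V) where
  star_involutive f := by ext v; simp [star_dual_apply]
  star_add f g := by ext v; simp [star_dual_apply]

instance : StarModule ℂ (StrongDual ℂ V) where
  star_smul c f := by ext v; simp [star_dual_apply]

instance : NormedStarGroup (StrongDual ℂ V) where
  norm_star_le f := LinearMap.mkContinuous_norm_le _ (norm_nonneg f) _

variable [MatrixOrderedOperatorSpace V]

open OperatorSpace MatrixOrdered MatrixOrderedOperatorSpace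

/-- `M_n(V^*)^+`: the self-adjoint `F` in `M_n(V^*) = CB(V, M_n)` that are completely positive,
that is, `F_m` maps `M_m(V)^+` to positive semidefinite matrices for every `m`. -/
def dualCone (V : Type*) [NormedAddCommGroup V] [NormedSpace ℂ V] [StarAddMonoid V]
    [NormedStarGroup V] [StarModule ℂ V] [MatrixOrderedOperatorSpace V] (n : ℕ) :
    Set (Mat n (StrongDual ℂ V)) :=
  {F | F.IsHermitian ∧ ∀ (m : ℕ) (x : Mat m V), x ∈ cone m → (ampl F x).PosSemidef}

theorem ampl_conjTranspose {n m : ℕ} (F : Mat n (StrongDual ℂ V)) (x : Mat m V) :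
    ampl Fᴴ x = (ampl F xᴴ)ᴴ := by
  ext p q; simp [ampl, star_dual_apply]

theorem dualNorm_conjTranspose_le {n : ℕ} (F : Mat n (StrongDual ℂ V)) :
    dualNorm Fᴴ ≤ dualNorm F := by
  refine dualNorm_le _ (dualNorm_nonneg F) fun m x => ?_
  rw [ampl_conjTranspose, Matrix.l2_opNorm_conjTranspose, ← mnorm_conjTranspose m x]
  exact norm_ampl_le F xᴴ

theorem dualNorm_conjTranspose {n : ℕ} (F : Mat n (StrongDual ℂ V)) :
    dualNorm Fᴴ = dualNorm F := by
  refine le_antisymm (dualNorm_conjTranspose_le F) ?_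
  simpa using dualNorm_conjTranspose_le Fᴴ

theorem dualCone_closed {n : ℕ} (F : Mat n (StrongDual ℂ V))
    (h : ∀ ε : ℝ, 0 < ε → ∃ G ∈ dualCone V n, dualNorm (F - G) < ε) : F ∈ dualCone V n := by
  have hherm : F.IsHermitian := by
    have h0 : dualNorm (Fᴴ - F) ≤ 0 := by
      refine le_of_forall_pos_le_add fun ε hε => ?_
      obtain ⟨G, hG, hFG⟩ := h (ε / 2) (by positivity)
      have h1 : Fᴴ - F = (F - G)ᴴ + (-1 : ℂ) • (F - G) := by
        rw [Matrix.conjTranspose_sub, hG.1.eq]; ext i j v; simp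
      have h2 := dualNorm_add_le (F - G)ᴴ ((-1 : ℂ) • (F - G))
      rw [← h1, dualNorm_conjTranspose, dualNorm_smul, norm_neg, norm_one] at h2
      linarith
    exact sub_eq_zero.1 (eq_zero_of_dualNorm _ (le_antisymm h0 (dualNorm_nonneg _)))
  refine ⟨hherm, fun m x hx => ?_⟩
  choose G hG hFG using fun k : ℕ => h (1 / ((k : ℝ) + 1)) (by positivity)
  have hlim : ∀ p q, Filter.Tendsto (fun k => ampl (G k) x p q) Filter.atTop
      (nhds (ampl F x p q)) := by
    intro p q
    rw [tendsto_iff_norm_sub_tendsto_zero]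
    refine squeeze_zero (fun _ => norm_nonneg _) (g := fun k : ℕ => 1 / ((k : ℝ) + 1) * mnorm m x)
      (fun k => ?_) (by simpa using tendsto_one_div_add_atTop_nhds_zero_nat.mul_const (mnorm m x))
    have h1 := (norm_entry_le (ampl (F - G k) x) p q).trans (norm_ampl_le (F - G k) x)
    have h2 : ‖ampl (G k) x p q - ampl F x p q‖ = ‖ampl (F - G k) x p q‖ := by
      rw [norm_sub_rev]; simp [ampl]
    rw [h2]
    exact h1.trans (mul_le_mul_of_nonneg_right (hFG k).le (mnorm_nonneg m x))
  refine Matrix.PosSemidef.of_dotProduct_mulVec_nonneg ?_ fun v => ?_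
  · have hx' : xᴴ = x := (cone_isHermitian m x hx).eq
    have h1 := ampl_conjTranspose F x
    rw [hx', hherm.eq] at h1
    exact h1.symm
  · have h1 : Filter.Tendsto (fun k => star v ⬝ᵥ (ampl (G k) x *ᵥ v)) Filter.atTop
        (nhds (star v ⬝ᵥ (ampl F x *ᵥ v))) := by
      simp only [dotProduct, Matrix.mulVec]
      exact tendsto_finsetSum _ fun p _ => tendsto_const_nhds.mul
        (tendsto_finsetSum _ fun q _ => (hlim p q).mul_const _)
    exact ge_of_tendsto' h1 fun k => ((hG k).2 m x hx).dotProduct_mulVec_nonneg v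

theorem conjTranspose_bimul {W : Type*} [AddCommGroup W] [Module ℂ W] [StarAddMonoid W]
    [StarModule ℂ W] {m n : ℕ} (α : Matrix (Fin n) (Fin m) ℂ) (x : Mat m W)
    (β : Matrix (Fin m) (Fin n) ℂ) : (bimul α x β)ᴴ = bimul βᴴ xᴴ αᴴ := by
  ext i j
  simp only [bimul, Matrix.conjTranspose_apply, Matrix.of_apply, star_sum, star_smul, star_mul']
  rw [Finset.sum_comm]
  simp only [mul_comm]

/-- The dual matrix ordered operator space `V^*`. -/
instance : MatrixOrderedOperatorSpace (StrongDual ℂ V) where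
  cone := dualCone V
  cone_isHermitian _ _ h := h.1
  cone_zero n := ⟨by simp [Matrix.IsHermitian], fun m x _ => by
    have : ampl (0 : Mat n (StrongDual ℂ V)) x = 0 := by ext p q; simp [ampl]
    rw [this]; exact Matrix.PosSemidef.zero⟩
  cone_add _ F G hF hG := ⟨hF.1.add hG.1, fun m x hx => by
    rw [ampl_add]; exact (hF.2 m x hx).add (hG.2 m x hx)⟩
  cone_smul _ r F hr hF := ⟨by
      simp [Matrix.IsHermitian, Matrix.conjTranspose_smul, hF.1.eq], fun m x hx => by
    rw [ampl_smul]
    exact (hF.2 m x hx).smul (by exact_mod_cast hr)⟩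
  cone_bimul m n α F hF := ⟨by
      rw [Matrix.IsHermitian, conjTranspose_bimul, hF.1.eq, Matrix.conjTranspose_conjTranspose],
    fun l x hx => by
      rw [ampl_bimul]
      have h := (hF.2 l x hx).conjTranspose_mul_mul_same ((1 : Matrix (Fin l) (Fin l) ℂ) ⊗ₖ α)
      rwa [Matrix.conjTranspose_kronecker, Matrix.conjTranspose_one] at h⟩
  mnorm_conjTranspose _ := dualNorm_conjTranspose
  cone_closed _ := dualCone_closed

end Star

end Dual

/-! ### Operator systems and matrix regular operator spaces -/

section Notions

open OperatorSpace MatrixOrdered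

variable (V : Type*) [NormedAddCommGroup V] [NormedSpace ℂ V] [StarAddMonoid V]
  [StarModule ℂ V] [MatrixOrderedOperatorSpace V]

/-- The positive part of the closed unit ball of the Banach space dual of `M_n(V)`. -/
def positiveBall (n : ℕ) : Set (Mat n V →ₗ[ℂ] ℂ) :=
  {φ | (∀ y, ‖φ y‖ ≤ mnorm n y) ∧ (∀ y, φ yᴴ = star (φ y)) ∧ ∀ y ∈ cone n, 0 ≤ φ y}

variable {V} in
/-- The modified numerical radius
`ν(x) = sup {|φ([0 x; x* 0])| : φ a positive functional of norm at most 1 on M_{2n}(V)}`. -/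
def numRadius {n : ℕ} (x : Mat n V) : ℝ :=
  sSup {r : ℝ | ∃ φ ∈ positiveBall V (n + n), r = ‖φ (block 0 x xᴴ 0)‖}

/-- A (nonunital) operator system in the sense of Werner. -/
structure IsOperatorSystem : Prop where
  proper : ∀ (n : ℕ) (x : Mat n V), x ∈ cone n → -x ∈ cone n → x = 0
  dominated : ∃ k : ℝ, 0 < k ∧ ∀ (n : ℕ) (x : Mat n V), mnorm n x ≤ k * numRadius x

/-- A matrix regular operator space in the sense of Schreiner; `-u ≤ v ≤ u` is spelled out as
`v + u ∈ M_n(V)^+` and `u - v ∈ M_n(V)^+`. -/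
structure IsMatrixRegular : Prop where
  complete : CompleteSpace V
  norm_le : ∀ (n : ℕ) (v u : Mat n V), v.IsHermitian → u ∈ cone n →
    v + u ∈ cone n → u - v ∈ cone n → mnorm n v ≤ mnorm n u
  exists_dominating : ∀ (n : ℕ) (v : Mat n V), v.IsHermitian → mnorm n v < 1 →
    ∃ u ∈ cone n, mnorm n u < 1 ∧ v + u ∈ cone n ∧ u - v ∈ cone n

variable {V}
variable {W : Type*} [NormedAddCommGroup W] [NormedSpace ℂ W] [StarAddMonoid W]
  [StarModule ℂ W] [MatrixOrderedOperatorSpace W]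

/-- `Φ` is completely bounded: its amplifications `Φ_n` are uniformly bounded. -/
def IsCompletelyBounded (Φ : V →ₗ[ℂ] W) : Prop :=
  ∃ C : ℝ, ∀ (n : ℕ) (x : Mat n V), mnorm n (x.map Φ) ≤ C * mnorm n x

/-- `Φ` is a complete isomorphism: a linear bijection, completely bounded in both directions. -/
def IsCompleteIso (Φ : V ≃ₗ[ℂ] W) : Prop :=
  IsCompletelyBounded (Φ : V →ₗ[ℂ] W) ∧ IsCompletelyBounded (Φ.symm : W →ₗ[ℂ] V)

/-- `Φ` is a complete order isomorphism: a self-adjoint linear bijection all of whose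
amplifications map positive cones onto positive cones. -/
def IsCompleteOrderIso (Φ : V ≃ₗ[ℂ] W) : Prop :=
  (∀ v, Φ (star v) = star (Φ v)) ∧
    ∀ (n : ℕ) (x : Mat n V), x.map Φ ∈ cone n ↔ x ∈ cone n

end Notions

end OpSys

end

/-! Call `x` dominated by `a` and `d` when `[a x; x* d] ≥ 0`. The new norm is `regNorm x = inf max
‖a‖ ‖d‖` over all such `a`, `d`, on the same space with the same cones. Conjugating the block matrix
by scalar matrices gives Ruan's axioms, and compressing it by `(1, ±1)` turns domination of a
self-adjoint `x` into `-c ≤ x ≤ c` with `c = (a + d)/2`, which gives matrix regularity. What remains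
is that `regNorm` is equivalent to the given norms, uniformly in `n`.

One estimate comes from `V` being an operator system: a positive functional on `M_{2n}(V)` is
nonnegative at `[a ±x; ±x* d]`, so `ν(x) ≤ max ‖a‖ ‖d‖` (`IsDominated.numRadius_le`), and the norm
is at most a multiple of `ν`.

The other, that every `x` is dominated by some `a`, `d` of norm at most `C ‖x‖`, comes from `V^*`
being an operator system. If `x` is far from all elements dominated with such bounds, Hahn-Banach
gives a positive functional on `M_{2n}(V)`, that is a positive `[A F; F* D]` over `V^*`, large at
`[0 x; x* 0]` but with `A`, `D` bounded as functionals. These bounds are of trace-class type,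
whereas the operator system inequality of `V^*` concerns completely bounded norms. Ruan's
factorization (`exists_isUnit_dualNorm_twist_le`) bridges the gap: `A = B* A' B` and `D = T* D' T`
with `A'`, `D'` of cb-norm at most 2 and `B`, `T` of controlled Hilbert-Schmidt norm. Then `F' =
B⁻¹* F T⁻¹` is dominated by `A'` and `D'`, so its cb-norm is bounded, hence `F(x)` is too
(`le_mnorm_of_forall_isDominated`). This contradiction yields approximate domination; summing a
geometric series, by completeness and closed cones, makes it exact (`exists_isDominated`). -/

noncomputable section

namespace OpSys

set_option linter.unusedSectionVars false
set_option linter.unusedSimpArgs false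

open scoped Matrix.Norms.L2Operator ComplexOrder Matrix Kronecker

/-! ### Scalar bimodule action and block matrices -/

section BlockAlgebra

variable {V : Type*} [AddCommGroup V] [Module ℂ V] {k l m n : ℕ}

theorem bimul_smul (c : ℂ) (α : Matrix (Fin n) (Fin m) ℂ) (x : Mat m V)
    (β : Matrix (Fin m) (Fin n) ℂ) : bimul α (c • x) β = c • bimul α x β := by
  ext i j; simp [bimul, Finset.smul_sum, smul_comm c]

@[simp] theorem bimul_zero (α : Matrix (Fin n) (Fin m) ℂ) (β : Matrix (Fin m) (Fin n) ℂ) :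
    bimul α (0 : Mat m V) β = 0 := by
  ext i j; simp [bimul]

@[simp] theorem zero_bimul (x : Mat m V) (β : Matrix (Fin m) (Fin n) ℂ) :
    bimul 0 x β = 0 := by
  ext i j; simp [bimul]

@[simp] theorem bimul_zero_right (α : Matrix (Fin n) (Fin m) ℂ) (x : Mat m V) :
    bimul α x 0 = 0 := by
  ext i j; simp [bimul]

@[simp] theorem neg_bimul (α : Matrix (Fin n) (Fin m) ℂ) (x : Mat m V)
    (β : Matrix (Fin m) (Fin n) ℂ) : bimul (-α) x β = -bimul α x β := by
  ext i j; simp [bimul]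

@[simp] theorem bimul_neg_right (α : Matrix (Fin n) (Fin m) ℂ) (x : Mat m V)
    (β : Matrix (Fin m) (Fin n) ℂ) : bimul α x (-β) = -bimul α x β := by
  ext i j; simp [bimul]

@[simp] theorem one_bimul_one (x : Mat n V) : bimul 1 x 1 = x := by
  ext i j; simp [bimul, Matrix.one_apply, ite_and]

theorem smul_bimul_smul (c d : ℂ) (α : Matrix (Fin n) (Fin m) ℂ) (x : Mat m V)
    (β : Matrix (Fin m) (Fin n) ℂ) : bimul (c • α) x (d • β) = (c * d) • bimul α x β := by
  ext i j
  simp only [bimul, Matrix.of_apply, Matrix.smul_apply, smul_eq_mul, Finset.smul_sum, smul_smul]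
  refine Finset.sum_congr rfl fun a _ => Finset.sum_congr rfl fun b _ => ?_
  congr 1; ring

theorem bimul_bimul (α : Matrix (Fin n) (Fin m) ℂ) (γ : Matrix (Fin m) (Fin k) ℂ) (x : Mat k V)
    (δ : Matrix (Fin k) (Fin m) ℂ) (β : Matrix (Fin m) (Fin n) ℂ) :
    bimul α (bimul γ x δ) β = bimul (α * γ) x (δ * β) := by
  ext i j
  simp only [bimul, Matrix.of_apply, Matrix.mul_apply, Finset.smul_sum, smul_smul,
    Finset.sum_mul_sum, Finset.sum_smul]
  have h : ∀ (f : Fin m → Fin m → Fin k → Fin k → V),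
      ∑ a, ∑ b, ∑ c, ∑ d, f a b c d = ∑ c, ∑ d, ∑ a, ∑ b, f a b c d := by
    intro f
    have h1 : ∀ a, ∑ b, ∑ c, ∑ d, f a b c d = ∑ c, ∑ d, ∑ b, f a b c d := fun a => by
      rw [Finset.sum_comm]
      exact Finset.sum_congr rfl fun c _ => Finset.sum_comm
    simp only [h1]
    rw [Finset.sum_comm]
    exact Finset.sum_congr rfl fun c _ => Finset.sum_comm
  rw [h]
  refine Finset.sum_congr rfl fun a _ => Finset.sum_congr rfl fun b _ =>
    Finset.sum_congr rfl fun c _ => Finset.sum_congr rfl fun d _ => ?_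
  congr 1; ring

/-- The scalar block matrix `[α β; γ δ]` with rectangular blocks. -/
def scalarBlock (α : Matrix (Fin k) (Fin m) ℂ) (β : Matrix (Fin k) (Fin n) ℂ)
    (γ : Matrix (Fin l) (Fin m) ℂ) (δ : Matrix (Fin l) (Fin n) ℂ) :
    Matrix (Fin (k + l)) (Fin (m + n)) ℂ :=
  (Matrix.fromBlocks α β γ δ).reindex finSumFinEquiv finSumFinEquiv

/-- The scalar row `[α β]`. -/
def scalarRow (α : Matrix (Fin k) (Fin m) ℂ) (β : Matrix (Fin k) (Fin n) ℂ) :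
    Matrix (Fin k) (Fin (m + n)) ℂ :=
  (Matrix.fromCols α β).reindex (Equiv.refl _) finSumFinEquiv

/-- The scalar column `[α; β]`. -/
def scalarCol (α : Matrix (Fin m) (Fin k) ℂ) (β : Matrix (Fin n) (Fin k) ℂ) :
    Matrix (Fin (m + n)) (Fin k) ℂ :=
  (Matrix.fromRows α β).reindex finSumFinEquiv (Equiv.refl _)

theorem conjTranspose_scalarBlock (α : Matrix (Fin k) (Fin m) ℂ) (β : Matrix (Fin k) (Fin n) ℂ)
    (γ : Matrix (Fin l) (Fin m) ℂ) (δ : Matrix (Fin l) (Fin n) ℂ) :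
    (scalarBlock α β γ δ)ᴴ = scalarBlock αᴴ γᴴ βᴴ δᴴ := by
  simp only [scalarBlock, Matrix.conjTranspose_reindex, Matrix.fromBlocks_conjTranspose]

theorem conjTranspose_scalarCol (α : Matrix (Fin m) (Fin k) ℂ) (β : Matrix (Fin n) (Fin k) ℂ) :
    (scalarCol α β)ᴴ = scalarRow αᴴ βᴴ := by
  ext i j
  refine Fin.addCases (fun j => ?_) (fun j => ?_) j <;> simp [scalarCol, scalarRow]

theorem scalarRow_mul_scalarCol (α : Matrix (Fin k) (Fin m) ℂ) (β : Matrix (Fin k) (Fin n) ℂ)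
    (γ : Matrix (Fin m) (Fin l) ℂ) (δ : Matrix (Fin n) (Fin l) ℂ) :
    scalarRow α β * scalarCol γ δ = α * γ + β * δ := by
  ext i j
  simp [scalarCol, scalarRow, Matrix.mul_apply, Fin.sum_univ_add]

theorem scalarRow_bimul_scalarCol (α : Matrix (Fin k) (Fin m) ℂ) (β : Matrix (Fin k) (Fin m) ℂ)
    (a b c d : Mat m V) (γ : Matrix (Fin m) (Fin k) ℂ) (δ : Matrix (Fin m) (Fin k) ℂ) :
    bimul (scalarRow α β) (block a b c d) (scalarCol γ δ)
      = bimul α a γ + bimul α b δ + bimul β c γ + bimul β d δ := by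
  ext i j
  simp [bimul, scalarRow, scalarCol, block, Fin.sum_univ_add, Finset.sum_add_distrib,
    -Fin.natAdd_eq_addNat]
  abel

theorem scalarRow_bimul_scalarCol_diag (α : Matrix (Fin k) (Fin m) ℂ)
    (β : Matrix (Fin k) (Fin n) ℂ) (a : Mat m V) (d : Mat n V) (γ : Matrix (Fin m) (Fin k) ℂ)
    (δ : Matrix (Fin n) (Fin k) ℂ) :
    bimul (scalarRow α β) (block a 0 0 d) (scalarCol γ δ) = bimul α a γ + bimul β d δ := by
  ext i j
  simp [bimul, scalarRow, scalarCol, block, Fin.sum_univ_add, Finset.sum_add_distrib]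

theorem scalarBlock_bimul_scalarBlock (α₁ α₂ α₃ α₄ : Matrix (Fin n) (Fin m) ℂ)
    (a b c d : Mat m V) (β₁ β₂ β₃ β₄ : Matrix (Fin m) (Fin n) ℂ) :
    bimul (scalarBlock α₁ α₂ α₃ α₄) (block a b c d) (scalarBlock β₁ β₂ β₃ β₄)
      = block (bimul α₁ a β₁ + bimul α₁ b β₃ + bimul α₂ c β₁ + bimul α₂ d β₃)
        (bimul α₁ a β₂ + bimul α₁ b β₄ + bimul α₂ c β₂ + bimul α₂ d β₄)
        (bimul α₃ a β₁ + bimul α₃ b β₃ + bimul α₄ c β₁ + bimul α₄ d β₃)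
        (bimul α₃ a β₂ + bimul α₃ b β₄ + bimul α₄ c β₂ + bimul α₄ d β₄) := by
  ext i j
  refine Fin.addCases (fun i => ?_) (fun i => ?_) i <;>
  refine Fin.addCases (fun j => ?_) (fun j => ?_) j <;>
  · simp [bimul, scalarBlock, block, Fin.sum_univ_add, Finset.sum_add_distrib,
      -Fin.natAdd_eq_addNat]
    abel

theorem block_add (a a' : Mat m V) (b b' : Matrix (Fin m) (Fin n) V)
    (c c' : Matrix (Fin n) (Fin m) V) (d d' : Mat n V) :
    block a b c d + block a' b' c' d' = block (a + a') (b + b') (c + c') (d + d') := by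
  ext i j
  refine Fin.addCases (fun i => ?_) (fun i => ?_) i <;>
  refine Fin.addCases (fun j => ?_) (fun j => ?_) j <;>
  simp [block]

theorem smul_block (r : ℂ) (a : Mat m V) (b : Matrix (Fin m) (Fin n) V)
    (c : Matrix (Fin n) (Fin m) V) (d : Mat n V) :
    r • block a b c d = block (r • a) (r • b) (r • c) (r • d) := by
  ext i j
  refine Fin.addCases (fun i => ?_) (fun i => ?_) i <;>
  refine Fin.addCases (fun j => ?_) (fun j => ?_) j <;>
  simp [block]

@[simp] theorem block_zero : block (0 : Mat m V) 0 0 (0 : Mat n V) = 0 := by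
  ext i j
  refine Fin.addCases (fun i => ?_) (fun i => ?_) i <;>
  refine Fin.addCases (fun j => ?_) (fun j => ?_) j <;>
  simp [block]

theorem conjTranspose_block [StarAddMonoid V] (a : Mat m V) (b : Matrix (Fin m) (Fin n) V)
    (c : Matrix (Fin n) (Fin m) V) (d : Mat n V) :
    (block a b c d)ᴴ = block aᴴ cᴴ bᴴ dᴴ := by
  simp only [block, Matrix.conjTranspose_reindex, Matrix.fromBlocks_conjTranspose]

/-- The inclusion `ℂ^m → ℂ^{m+n}` of the first summand. -/
def inlScalar (m n : ℕ) : Matrix (Fin (m + n)) (Fin m) ℂ := scalarCol 1 0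

/-- The inclusion `ℂ^n → ℂ^{m+n}` of the second summand. -/
def inrScalar (m n : ℕ) : Matrix (Fin (m + n)) (Fin n) ℂ := scalarCol 0 1

theorem inlScalar_bimul (a : Mat m V) (d : Mat n V) :
    bimul (inlScalar m n) a (inlScalar m n)ᴴ + bimul (inrScalar m n) d (inrScalar m n)ᴴ
      = block a 0 0 d := by
  ext i j
  refine Fin.addCases (fun i => ?_) (fun i => ?_) i <;>
  refine Fin.addCases (fun j => ?_) (fun j => ?_) j <;>
  simp [block, inlScalar, inrScalar, conjTranspose_scalarCol, bimul, scalarRow, scalarCol,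
    Matrix.one_apply, ite_and]

theorem bimul_inlScalar_block (a : Mat m V) (d : Mat n V) :
    bimul (inlScalar m n)ᴴ (block a 0 0 d) (inlScalar m n) = a := by
  rw [inlScalar, conjTranspose_scalarCol, scalarRow_bimul_scalarCol_diag]
  simp

theorem bimul_inrScalar_block (a : Mat m V) (d : Mat n V) :
    bimul (inrScalar m n)ᴴ (block a 0 0 d) (inrScalar m n) = d := by
  rw [inrScalar, conjTranspose_scalarCol, scalarRow_bimul_scalarCol_diag]
  simp

theorem norm_le_one_of_conjTranspose_mul_self {κ ι : Type*} [Fintype κ] [DecidableEq κ]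
    [Fintype ι] [DecidableEq ι] {α : Matrix κ ι ℂ} (h : αᴴ * α = 1) : ‖α‖ ≤ 1 := by
  have h1 := Matrix.l2_opNorm_conjTranspose_mul_self α
  have h2 : ‖(1 : Matrix ι ι ℂ)‖ ≤ 1 := by
    refine opNorm_le_of_form _ zero_le_one fun η ξ => ?_
    rw [form_eq_inner, Matrix.one_mulVec]
    simpa using norm_inner_le_norm (𝕜 := ℂ) η ξ
  rw [h] at h1
  nlinarith [norm_nonneg α]

theorem norm_inlScalar_le : ‖inlScalar m n‖ ≤ 1 := by
  refine norm_le_one_of_conjTranspose_mul_self ?_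
  rw [inlScalar, conjTranspose_scalarCol, scalarRow_mul_scalarCol]
  simp

theorem norm_inrScalar_le : ‖inrScalar m n‖ ≤ 1 := by
  refine norm_le_one_of_conjTranspose_mul_self ?_
  rw [inrScalar, conjTranspose_scalarCol, scalarRow_mul_scalarCol]
  simp

end BlockAlgebra

/-! ### Positive 2 × 2 block matrices and domination -/

section Dominated

open MatrixOrdered

variable {V : Type*} [AddCommGroup V] [Module ℂ V] [StarAddMonoid V] [StarModule ℂ V]
  [MatrixOrdered V] {m n : ℕ}

/-- `[a x; x* d]` is positive. -/
def IsDominated (a x d : Mat n V) : Prop := block a x xᴴ d ∈ cone (n + n)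

namespace IsDominated

theorem add {a x d a' x' d' : Mat n V} (h : IsDominated a x d) (h' : IsDominated a' x' d') :
    IsDominated (a + a') (x + x') (d + d') := by
  have := cone_add _ _ _ h h'
  rwa [block_add, ← Matrix.conjTranspose_add] at this

theorem zero : IsDominated (0 : Mat n V) 0 0 := by
  rw [IsDominated, Matrix.conjTranspose_zero, block_zero]
  exact cone_zero _

/-- Compression of the block matrix by the diagonal scalar matrix `αᴴ ⊕ β`, so that the two sides of
`x` may be multiplied independently. -/
theorem bimul {a x d : Mat m V} (h : IsDominated a x d) (α : Matrix (Fin n) (Fin m) ℂ)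
    (β : Matrix (Fin m) (Fin n) ℂ) :
    IsDominated (bimul α a αᴴ) (bimul α x β) (OpSys.bimul βᴴ d β) := by
  have := cone_bimul _ _ (scalarBlock αᴴ 0 0 β) _ h
  rw [conjTranspose_scalarBlock, scalarBlock_bimul_scalarBlock] at this
  simpa [IsDominated, conjTranspose_bimul] using this

theorem conjTranspose {a x d : Mat n V} (h : IsDominated a x d) : IsDominated d xᴴ a := by
  have := cone_bimul _ _ (scalarBlock (0 : Matrix (Fin n) (Fin n) ℂ)
    (1 : Matrix (Fin n) (Fin n) ℂ) (1 : Matrix (Fin n) (Fin n) ℂ) 0) _ h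
  rw [conjTranspose_scalarBlock, scalarBlock_bimul_scalarBlock] at this
  simpa [IsDominated] using this

theorem neg {a x d : Mat n V} (h : IsDominated a x d) : IsDominated a (-x) d := by
  have := h.bimul (1 : Matrix (Fin n) (Fin n) ℂ) (-1)
  simpa using this

theorem left_mem {a x d : Mat n V} (h : IsDominated a x d) : a ∈ cone n := by
  have := cone_bimul _ _ (scalarCol (1 : Matrix (Fin n) (Fin n) ℂ)
    (0 : Matrix (Fin n) (Fin n) ℂ)) _ h
  rw [conjTranspose_scalarCol, scalarRow_bimul_scalarCol] at this
  simpa using this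

theorem right_mem {a x d : Mat n V} (h : IsDominated a x d) : d ∈ cone n :=
  h.conjTranspose.left_mem

/-- Compression by the column `(1, -1)` gives `a + d - x - x*`, which is `a + d - 2x` for
self-adjoint `x`. -/
theorem add_sub_mem {a x d : Mat n V} (h : IsDominated a x d) (hx : x.IsHermitian) :
    (1 / 2 : ℂ) • (a + d) - x ∈ cone n := by
  have := cone_smul _ (1 / 2) _ (by norm_num)
    (cone_bimul _ _ (scalarCol (1 : Matrix (Fin n) (Fin n) ℂ)
    (-1 : Matrix (Fin n) (Fin n) ℂ)) _ h)
  rw [conjTranspose_scalarCol, scalarRow_bimul_scalarCol, hx.eq] at this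
  convert this using 1
  simp
  module

theorem add_add_mem {a x d : Mat n V} (h : IsDominated a x d) (hx : x.IsHermitian) :
    x + (1 / 2 : ℂ) • (a + d) ∈ cone n := by
  have h' := h.neg.add_sub_mem hx.neg
  rwa [sub_neg_eq_add, add_comm] at h'

/-- Converse to `add_sub_mem` and `add_add_mem`: `[u v; v u]` is half the sum of `(1 1)ᴴ (v + u) (1
1)` and `(1 -1)ᴴ (u - v) (1 -1)`. -/
theorem of_le {u v : Mat n V} (hv : v.IsHermitian) (h1 : v + u ∈ cone n) (h2 : u - v ∈ cone n) :
    IsDominated u v u := by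
  have h3 := cone_bimul _ _ (scalarRow (1 : Matrix (Fin n) (Fin n) ℂ)
    (1 : Matrix (Fin n) (Fin n) ℂ)) _ h1
  have h4 := cone_bimul _ _ (scalarRow (1 : Matrix (Fin n) (Fin n) ℂ)
    (-1 : Matrix (Fin n) (Fin n) ℂ)) _ h2
  have := cone_smul _ (1 / 2) _ (by norm_num) (cone_add _ _ _ h3 h4)
  rw [IsDominated, hv.eq]
  convert this using 1
  -- Only `s = 1` and `s = -1` are needed; a general `s` treats both signs at once.
  have key : ∀ (y : Mat n V) (s : ℂ),
      OpSys.bimul (scalarRow (1 : Matrix (Fin n) (Fin n) ℂ) (s • 1))ᴴ y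
      (scalarRow (1 : Matrix (Fin n) (Fin n) ℂ) (s • 1))
      = block y (s • y) (star s • y) ((star s * s) • y) := by
    intro y s
    ext i j
    refine Fin.addCases (fun i => ?_) (fun i => ?_) i <;>
    refine Fin.addCases (fun j => ?_) (fun j => ?_) j <;>
    simp [block, OpSys.bimul, scalarRow, Matrix.one_apply, ite_and,
      apply_ite (starRingEnd ℂ), -Fin.natAdd_eq_addNat]
  have k1 := key (v + u) 1
  have k2 := key (u - v) (-1)
  simp only [one_smul, neg_smul] at k1 k2
  rw [k1, k2, block_add, smul_block]
  congr 1 <;> simp <;> module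

theorem directSum {a x d : Mat m V} {a' x' d' : Mat n V} (h : IsDominated a x d)
    (h' : IsDominated a' x' d') :
    IsDominated (block a 0 0 a') (block x 0 0 x') (block d 0 0 d') := by
  have := (h.bimul (inlScalar m n) (inlScalar m n)ᴴ).add
    (h'.bimul (inrScalar m n) (inrScalar m n)ᴴ)
  simpa only [Matrix.conjTranspose_conjTranspose, inlScalar_bimul] using this

end IsDominated

end Dominated

/-! ### Hahn-Banach sandwich theorem and self-adjoint extensions -/

section HahnBanach

/-- Sandwich form of Hahn-Banach. The lower constraints, encoded by a convex cone below the graph of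
`N`, are absorbed into a smaller sublinear functional, so that a single upper bound remains. Taking
a cone of pairs, rather than a function, lets one vector carry several lower bounds. -/
theorem exists_linearMap_between {E : Type*} [AddCommGroup E] [Module ℝ E] (N : E → ℝ)
    (N_hom : ∀ c : ℝ, 0 < c → ∀ x, N (c • x) = c * N x) (N_add : ∀ x y, N (x + y) ≤ N x + N y)
    (K : ConvexCone ℝ (E × ℝ)) (h0 : (0 : E × ℝ) ∈ K) (hK : ∀ p ∈ K, p.2 ≤ N p.1) :
    ∃ ψ : E →ₗ[ℝ] ℝ, (∀ e, ψ e ≤ N e) ∧ ∀ p ∈ K, p.2 ≤ ψ p.1 := by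
  have : Nonempty K := ⟨⟨0, h0⟩⟩
  -- The infimal convolution of `N` with the lower constraints; it is finite because `p.2 ≤ N p.1 ≤
  -- N (e + p.1) + N (-e)`.
  set S : E → ℝ := fun e => ⨅ p : K, (N (e + p.1.1) - p.1.2) with hS
  have hbdd : ∀ e, BddBelow (Set.range fun p : K => N (e + p.1.1) - p.1.2) := by
    intro e
    refine ⟨-N (-e), ?_⟩
    rintro _ ⟨p, rfl⟩
    have h1 := N_add (e + p.1.1) (-e)
    have h2 := hK p.1 p.2
    rw [show e + p.1.1 + -e = p.1.1 by abel] at h1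
    dsimp only
    linarith
  have hSle : ∀ e, ∀ p ∈ K, S e ≤ N (e + p.1) - p.2 := fun e p hp =>
    ciInf_le (hbdd e) (⟨p, hp⟩ : K)
  have hle : ∀ c : ℝ, 0 < c → ∀ x, S (c • x) ≤ c * S x := by
    intro c hc x
    rw [hS]
    simp only
    rw [Real.mul_iInf_of_nonneg hc.le]
    refine le_ciInf fun p => ?_
    have h1 := hSle (c • x) (c • p.1) (K.smul_mem hc p.2)
    rw [show (c • (p : E × ℝ)).1 = c • p.1.1 from rfl,
      show (c • (p : E × ℝ)).2 = c • p.1.2 from rfl, ← smul_add, N_hom c hc, smul_eq_mul] at h1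
    rw [mul_sub]
    exact h1
  have hhom : ∀ c : ℝ, 0 < c → ∀ x, S (c • x) = c * S x := by
    intro c hc x
    refine le_antisymm (hle c hc x) ?_
    have h1 := hle c⁻¹ (inv_pos.2 hc) (c • x)
    rw [smul_smul, inv_mul_cancel₀ hc.ne', one_smul] at h1
    rwa [le_inv_mul_iff₀ hc] at h1
  have hadd : ∀ x y, S (x + y) ≤ S x + S y := by
    intro x y
    refine le_of_forall_pos_le_add fun ε hε => ?_
    obtain ⟨p, hp⟩ := exists_lt_of_ciInf_lt (show S x < S x + ε / 2 by linarith)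
    obtain ⟨q, hq⟩ := exists_lt_of_ciInf_lt (show S y < S y + ε / 2 by linarith)
    have h1 := hSle (x + y) (p.1 + q.1) (K.add_mem p.2 q.2)
    have h2 := N_add (x + p.1.1) (y + q.1.1)
    rw [show x + p.1.1 + (y + q.1.1) = x + y + (p.1 + q.1).1 by simp; abel] at h2
    have h3 : (p.1 + q.1).2 = p.1.2 + q.1.2 := rfl
    linarith
  obtain ⟨ψ, -, hψ⟩ := exists_extension_of_le_sublinear (⊥ : E →ₗ.[ℝ] ℝ) S hhom hadd (by
    rintro ⟨x, hx⟩
    have hx0 : x = 0 := (Submodule.mem_bot ℝ).1 hx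
    subst hx0
    have h1 := hhom 2 two_pos 0
    rw [smul_zero] at h1
    have h2 : S 0 = 0 := by linarith
    have h3 : (⟨0, hx⟩ : (⊥ : E →ₗ.[ℝ] ℝ).domain) = 0 := rfl
    rw [h3, LinearPMap.map_zero, ZeroMemClass.coe_zero, h2])
  have hN0 : N 0 = 0 := by
    have h1 := N_hom 2 two_pos 0
    rw [smul_zero] at h1
    linarith
  refine ⟨ψ, fun e => (hψ e).trans (by simpa using hSle e 0 h0), fun p hp => ?_⟩
  -- Evaluating at `-p.1` turns the upper bound `S` into the lower bound at `p.1`.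
  have h1 := (hψ (-p.1)).trans (hSle (-p.1) p hp)
  rw [neg_add_cancel, hN0, map_neg] at h1
  linarith

/-- A real linear functional, symmetrised and extended to a self-adjoint complex linear one. -/
theorem exists_selfAdjoint_extension {E : Type*} [AddCommGroup E] [Module ℂ E] [StarAddMonoid E]
    [StarModule ℂ E] (ψ : E →ₗ[ℝ] ℝ) :
    ∃ G : E →ₗ[ℂ] ℂ, (∀ y, G (star y) = star (G y)) ∧ (∀ y, star y = y → G y = ψ y) ∧
      ∀ y, (G y).re = (ψ y + ψ (star y)) / 2 := by
  let ψ' : Module.Dual ℝ E :=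
    { toFun := fun y => (ψ y + ψ (star y)) / 2
      map_add' := fun x y => by simp only [star_add, map_add]; ring
      map_smul' := fun c y => by
        have : star (c • y) = c • star y := by
          rw [← Complex.coe_smul, star_smul, Complex.star_def, Complex.conj_ofReal, Complex.coe_smul]
        simp only [this, map_smul, smul_eq_mul, RingHom.id_apply]; ring }
  have hψ' : ∀ y, ψ' y = (ψ y + ψ (star y)) / 2 := fun _ => rfl
  have hstar : ∀ y, ψ' (star y) = ψ' y := fun y => by rw [hψ', hψ', star_star, add_comm]
  refine ⟨Module.Dual.extendRCLike (𝕜 := ℂ) ψ', fun y => ?_, fun y hy => ?_, fun y => ?_⟩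
  · have h1 : (Complex.I • star y) = - star (Complex.I • y) := by simp [star_smul]
    simp only [Module.Dual.extendRCLike_apply, RCLike.I_to_complex]
    rw [h1, map_neg, hstar, hstar]
    simp
  -- For self-adjoint `y` the element `i y` is skew-adjoint, and the symmetrised functional kills
  -- it.
  · have h1 : ψ' (Complex.I • y) = 0 := by
      rw [hψ', star_smul, hy]; simp
    simp only [Module.Dual.extendRCLike_apply, RCLike.I_to_complex]
    rw [h1, hψ', hy]
    simp
  · exact Module.Dual.re_extendRCLike_apply (𝕜 := ℂ) ψ' y

end HahnBanach

/-! ### Hilbert-Schmidt norm -/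

section HilbertSchmidt

variable {k l m n : ℕ}

/-- A matrix as a vector of the Hilbert space of its entries. -/
def matVec (η : Matrix (Fin m) (Fin n) ℂ) : EuclideanSpace ℂ (Fin m × Fin n) :=
  WithLp.toLp 2 fun p => η p.1 p.2

/-- The Hilbert-Schmidt norm. -/
def hsNorm (η : Matrix (Fin m) (Fin n) ℂ) : ℝ := ‖matVec η‖

theorem hsNorm_nonneg (η : Matrix (Fin m) (Fin n) ℂ) : 0 ≤ hsNorm η := norm_nonneg _

theorem hsNorm_sq (η : Matrix (Fin m) (Fin n) ℂ) : hsNorm η ^ 2 = ∑ i, ∑ j, ‖η i j‖ ^ 2 := by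
  simp [hsNorm, EuclideanSpace.norm_sq_eq, Fintype.sum_prod_type, matVec]

theorem hsNorm_smul (c : ℂ) (η : Matrix (Fin m) (Fin n) ℂ) :
    hsNorm (c • η) = ‖c‖ * hsNorm η := norm_smul c (matVec η)

theorem hsNorm_transpose (η : Matrix (Fin m) (Fin n) ℂ) : hsNorm ηᵀ = hsNorm η := by
  rw [← sq_eq_sq₀ (hsNorm_nonneg _) (hsNorm_nonneg _), hsNorm_sq, hsNorm_sq, Finset.sum_comm]
  rfl

end HilbertSchmidt

/-! ### Matrices over the dual as functionals on matrices -/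

section Pairing

variable {V : Type*} [NormedAddCommGroup V] [NormedSpace ℂ V] {k l m n : ℕ}

/-- The linear functional `y ↦ ∑ f_ij(y_ij)` on `M_n(V)` defined by `[f_ij]` in `M_n(V^*)`. -/
def pairing (F : Mat n (StrongDual ℂ V)) : Mat n V →ₗ[ℂ] ℂ where
  toFun y := ∑ i, ∑ j, F i j (y i j)
  map_add' x y := by simp [Finset.sum_add_distrib]
  map_smul' c x := by simp [Finset.mul_sum]

theorem pairing_apply (F : Mat n (StrongDual ℂ V)) (y : Mat n V) :
    pairing F y = ∑ i, ∑ j, F i j (y i j) := rfl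

/-- The bridge between the two readings of `F`: a matrix coefficient of the amplification at `x` is
the functional `pairing F` at a scalar compression of `x`. Hence cb-norms and complete positivity of
`F` can be read off from `pairing F`. -/
theorem form_ampl (F : Mat n (StrongDual ℂ V)) (x : Mat m V) (η ξ : Fin m × Fin n → ℂ) :
    ∑ p, ∑ q, star (η p) * ampl F x p q * ξ q
      = pairing F (bimul (Matrix.of fun a i => η (a, i))ᴴ x (Matrix.of fun a i => ξ (a, i))) := by
  simp only [pairing_apply, bimul, Fintype.sum_prod_type, ampl, Matrix.of_apply, map_sum, map_smul,
    smul_eq_mul, Matrix.conjTranspose_apply]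
  rw [Finset.sum_comm]
  refine Finset.sum_congr rfl fun i _ => ?_
  rw [Finset.sum_comm' (t' := Finset.univ) (s' := fun _ => Finset.univ) (by simp)]
  conv_rhs => rw [Finset.sum_comm]
  rw [Finset.sum_comm]
  refine Finset.sum_congr rfl fun a _ => ?_
  rw [Finset.sum_comm]
  refine Finset.sum_congr rfl fun j _ => Finset.sum_congr rfl fun b _ => ?_
  ring

/-- The pairing is entrywise, with no trace involved, so the scalar factors pass to the other side
with plain transposes. This is where the transposes below come from. -/
theorem pairing_bimul (α : Matrix (Fin n) (Fin m) ℂ) (F : Mat m (StrongDual ℂ V))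
    (β : Matrix (Fin m) (Fin n) ℂ) (y : Mat n V) :
    pairing (bimul α F β) y = pairing F (bimul αᵀ y βᵀ) := by
  simp only [pairing_apply, bimul, Matrix.of_apply, Matrix.transpose_apply, map_sum, map_smul,
    sum_apply, smul_apply, smul_eq_mul]
  have h : ∀ (f : Fin n → Fin n → Fin m → Fin m → ℂ),
      ∑ a, ∑ b, ∑ c, ∑ d, f a b c d = ∑ c, ∑ d, ∑ a, ∑ b, f a b c d := by
    intro f
    have h1 : ∀ a, ∑ b, ∑ c, ∑ d, f a b c d = ∑ c, ∑ d, ∑ b, f a b c d := fun a => by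
      rw [Finset.sum_comm]
      exact Finset.sum_congr rfl fun c _ => Finset.sum_comm
    simp only [h1]
    rw [Finset.sum_comm]
    exact Finset.sum_congr rfl fun c _ => Finset.sum_comm
  rw [h]

theorem norm_pairing_bimul_le [OperatorSpace V] (F : Mat n (StrongDual ℂ V)) (x : Mat m V)
    (η ξ : Matrix (Fin m) (Fin n) ℂ) :
    ‖pairing F (bimul ηᴴ x ξ)‖ ≤ dualNorm F * OperatorSpace.mnorm m x * hsNorm η * hsNorm ξ := by
  have h := norm_form_le (ampl F x) (matVec η) (matVec ξ)
  rw [form_ampl] at h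
  refine h.trans ?_
  have := norm_ampl_le F x
  have h1 := hsNorm_nonneg η
  have h2 := hsNorm_nonneg ξ
  unfold hsNorm at *
  gcongr

theorem dualNorm_le_of_pairing [OperatorSpace V] (F : Mat n (StrongDual ℂ V)) {C : ℝ} (hC : 0 ≤ C)
    (h : ∀ (m : ℕ) (x : Mat m V) (η ξ : Matrix (Fin m) (Fin n) ℂ), OperatorSpace.mnorm m x ≤ 1 →
      ‖pairing F (bimul ηᴴ x ξ)‖ ≤ C * hsNorm η * hsNorm ξ) : dualNorm F ≤ C := by
  refine Real.sSup_le ?_ hC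
  rintro r ⟨m, x, hx, rfl⟩
  refine opNorm_le_of_form _ hC fun η ξ => ?_
  rw [form_ampl]
  exact h m x _ _ hx

/-- Positivity on `M_n(V)` alone already gives complete positivity: by `form_ampl` the quadratic
form of the amplification at `x ≥ 0` is the functional at a compression of `x`, which lies in the
cone of `M_n(V)`. -/
theorem mem_dualCone_of_pairing [StarAddMonoid V] [NormedStarGroup V] [StarModule ℂ V]
    [MatrixOrderedOperatorSpace V] (F : Mat n (StrongDual ℂ V))
    (hstar : ∀ y, pairing F yᴴ = star (pairing F y))
    (hpos : ∀ y ∈ MatrixOrdered.cone n, 0 ≤ pairing F y) : F ∈ dualCone V n := by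
  have hF : F.IsHermitian := by
    ext i j v
    -- Matrix units recover the entries of `F` from its pairing.
    have h := hstar (Matrix.single j i (star v))
    have e : ∀ (a b : Fin n) (w : V), pairing F (Matrix.single a b w) = F a b w := by
      intro a b w
      rw [pairing_apply, Finset.sum_eq_single a, Finset.sum_eq_single b]
      · simp
      · intro c _ hc; simp [Matrix.single_apply, hc.symm]
      · simp
      · intro c _ hc; simp [Matrix.single_apply, hc.symm]
      · simp
    rw [Matrix.conjTranspose_single, star_star, e, e] at h
    rw [Matrix.conjTranspose_apply, star_dual_apply, h]
  refine ⟨hF, fun m x hx => Matrix.PosSemidef.of_dotProduct_mulVec_nonneg ?_ fun v => ?_⟩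
  · have h1 := ampl_conjTranspose F x
    rw [(MatrixOrdered.cone_isHermitian m x hx).eq, hF.eq] at h1
    exact h1.symm
  · have h1 : star v ⬝ᵥ (ampl F x *ᵥ v) = ∑ p, ∑ q, star (v p) * ampl F x p q * v q := by
      simp [dotProduct, Matrix.mulVec, Finset.mul_sum, mul_assoc]
    rw [h1, form_ampl]
    exact hpos _ (MatrixOrdered.cone_bimul _ _ _ _ hx)

end Pairing

/-! ### Ruan's factorization of functionals on `M_n(V)` -/

section Factorization

open OperatorSpace

variable {V : Type*} [NormedAddCommGroup V] [NormedSpace ℂ V] {k l m n : ℕ}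

open scoped MatrixOrder in
theorem sq_norm_le_norm_add (η : Matrix (Fin m) (Fin n) ℂ) {t : Matrix (Fin n) (Fin n) ℂ}
    (ht : t.PosSemidef) : ‖η‖ * ‖η‖ ≤ ‖ηᴴ * η + t‖ := by
  rw [← Matrix.l2_opNorm_conjTranspose_mul_self]
  refine CStarAlgebra.norm_le_norm_of_nonneg_of_le
    (Matrix.posSemidef_conjTranspose_mul_self η).nonneg ?_
  rw [Matrix.le_iff]
  simpa using ht

/-- The state-like functional controlling a bounded functional on `M_n(V)`. -/
theorem exists_dominating_scalar_functional [OperatorSpace V] (f : Mat n V →ₗ[ℂ] ℂ) {C : ℝ}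
    (hC : 0 ≤ C) (hf : ∀ y, ‖f y‖ ≤ C * mnorm n y) :
    ∃ P : Mat n ℂ →ₗ[ℂ] ℂ, (∀ t, P tᴴ = star (P t)) ∧ (P 1).re ≤ C ∧
      ∀ (r : ℕ) (x : Mat r V) (η ξ : Matrix (Fin r) (Fin n) ℂ), mnorm r x ≤ 1 →
        (f (bimul ηᴴ x ξ)).re ≤ (P (ηᴴ * η + ξᴴ * ξ)).re := by
  let K : ConvexCone ℝ (Mat n ℂ × ℝ) :=
    { carrier := {p | ∃ (r : ℕ) (x : Mat r V) (η ξ : Matrix (Fin r) (Fin n) ℂ), mnorm r x ≤ 1 ∧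
        p = (ηᴴ * η + ξᴴ * ξ, (f (bimul ηᴴ x ξ)).re)}
      smul_mem' := by
        rintro c hc _ ⟨r, x, η, ξ, hx, rfl⟩
        have hs : ((Real.sqrt c : ℝ) : ℂ) * ((Real.sqrt c : ℝ) : ℂ) = (c : ℂ) := by
          rw [← Complex.ofReal_mul, Real.mul_self_sqrt hc.le]
        -- The pair is quadratic in `(η, ξ)`, so scaling by `c` means scaling both by `√c`.
        refine ⟨r, x, ((Real.sqrt c : ℝ) : ℂ) • η, ((Real.sqrt c : ℝ) : ℂ) • ξ, hx, ?_⟩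
        rw [Matrix.conjTranspose_smul, Matrix.conjTranspose_smul, smul_bimul_smul]
        simp only [Complex.star_def, Complex.conj_ofReal, Matrix.smul_mul, Matrix.mul_smul,
          smul_smul, hs, map_smul, ← smul_add]
        refine Prod.ext ?_ ?_
        · exact (Complex.coe_smul c _).symm
        · simp
      add_mem' := by
        rintro _ ⟨r, x, η, ξ, hx, rfl⟩ _ ⟨s, y, η', ξ', hy, rfl⟩
        -- Convexity comes from direct sums: `x ⊕ y` stays in the unit ball by Ruan's axiom. For
        -- this reason all sizes `r` are admitted.
        refine ⟨r + s, block x 0 0 y, scalarCol η η', scalarCol ξ ξ', ?_, ?_⟩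
        · rw [mnorm_block]; exact max_le hx hy
        · simp only [conjTranspose_scalarCol, scalarRow_mul_scalarCol,
            scalarRow_bimul_scalarCol_diag, map_add, Complex.add_re, Prod.mk_add_mk]
          refine Prod.ext ?_ rfl
          simp only
          abel }
  obtain ⟨ψ, hψN, hψK⟩ := exists_linearMap_between (fun t : Mat n ℂ => C * ‖t‖)
    (fun c hc x => by rw [norm_smul, Real.norm_of_nonneg hc.le]; ring)
    (fun x y => by rw [← mul_add]; exact mul_le_mul_of_nonneg_left (norm_add_le _ _) hC) K
    ⟨0, 0, 0, 0, by rw [mnorm_zero]; exact zero_le_one, Prod.ext (by simp) (by simp)⟩ (by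
      rintro _ ⟨r, x, η, ξ, hx, rfl⟩
      have h1 : (f (bimul ηᴴ x ξ)).re ≤ C * (‖η‖ * ‖ξ‖) := by
        refine (Complex.re_le_norm _).trans ((hf _).trans (mul_le_mul_of_nonneg_left ?_ hC))
        refine (mnorm_bimul_le _ _ _ _ _).trans ?_
        rw [Matrix.l2_opNorm_conjTranspose]
        have := mul_le_mul_of_nonneg_left hx (norm_nonneg η)
        calc ‖η‖ * mnorm r x * ‖ξ‖ ≤ ‖η‖ * 1 * ‖ξ‖ := by gcongr
          _ = _ := by ring
      -- Both `‖η‖²` and `‖ξ‖²` are at most `‖ηᴴη + ξᴴξ‖`, hence so is their geometric mean.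
      refine h1.trans (mul_le_mul_of_nonneg_left ?_ hC)
      have h2 := sq_norm_le_norm_add η (Matrix.posSemidef_conjTranspose_mul_self ξ)
      have h3 := sq_norm_le_norm_add ξ (Matrix.posSemidef_conjTranspose_mul_self η)
      rw [add_comm] at h3
      nlinarith [sq_nonneg (‖η‖ - ‖ξ‖)])
  obtain ⟨P, hP1, hP2, -⟩ := exists_selfAdjoint_extension ψ
  refine ⟨P, hP1, ?_, fun r x η ξ hx => ?_⟩
  · rw [hP2 1 (star_one _), Complex.ofReal_re]
    refine (hψN 1).trans ?_
    have h1 : ‖(1 : Mat n ℂ)‖ ≤ 1 := norm_le_one_of_conjTranspose_mul_self (by simp)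
    simpa using mul_le_mul_of_nonneg_left h1 hC
  · rw [hP2 _ (by simp [Matrix.star_eq_conjTranspose]), Complex.ofReal_re]
    exact hψK _ ⟨r, x, η, ξ, hx, rfl⟩

theorem linearMap_matrix_apply (P : Mat n ℂ →ₗ[ℂ] ℂ) (t : Mat n ℂ) :
    P t = ∑ i, ∑ j, t i j * P (Matrix.single i j 1) := by
  conv_lhs => rw [Matrix.matrix_eq_sum_single t]
  simp only [map_sum]
  refine Finset.sum_congr rfl fun i _ => Finset.sum_congr rfl fun j _ => ?_
  rw [← smul_eq_mul, ← map_smul, Matrix.smul_single, smul_eq_mul, mul_one]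

open scoped MatrixOrder in
/-- A bounded functional on `M_n(V)` is controlled by a Hilbert-Schmidt norm. -/
theorem exists_isUnit_hsNorm_bound [OperatorSpace V] (f : Mat n V →ₗ[ℂ] ℂ) {C : ℝ}
    (hC : 0 < C) (hf : ∀ y, ‖f y‖ ≤ C * mnorm n y) :
    ∃ B : Matrix (Fin n) (Fin n) ℂ, IsUnit B ∧ hsNorm B ^ 2 ≤ 2 * C ∧
      ∀ (r : ℕ) (x : Mat r V) (η ξ : Matrix (Fin r) (Fin n) ℂ), mnorm r x ≤ 1 →
        (f (bimul ηᴴ x ξ)).re ≤ hsNorm (η * Bᵀ) ^ 2 + hsNorm (ξ * Bᵀ) ^ 2 := by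
  obtain ⟨P, hPstar, hP1, hPf⟩ := exists_dominating_scalar_functional f hC.le hf
  have hPpos : ∀ {r : ℕ} (η : Matrix (Fin r) (Fin n) ℂ), 0 ≤ (P (ηᴴ * η)).re := by
    intro r η
    -- The inequality at `x = 0` says that `P` is positive.
    have h := hPf r 0 η 0 (by rw [mnorm_zero]; exact zero_le_one)
    simpa using h
  set Q : Matrix (Fin n) (Fin n) ℂ := Matrix.of fun i j => P (Matrix.single i j 1) with hQ
  have hPQ : ∀ {r : ℕ} (η : Matrix (Fin r) (Fin n) ℂ),
      P (ηᴴ * η) = ∑ k, star (η k) ⬝ᵥ (Q *ᵥ η k) := by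
    intro r η
    rw [linearMap_matrix_apply]
    simp only [Matrix.mul_apply, dotProduct, Matrix.mulVec, Finset.sum_mul, Finset.mul_sum, hQ,
      Matrix.of_apply, Matrix.conjTranspose_apply, Pi.star_apply]
    rw [Finset.sum_comm' (t' := Finset.univ) (s' := fun _ => Finset.univ) (by simp)]
    rw [Finset.sum_comm]
    conv_rhs => rw [Finset.sum_comm]
    refine Finset.sum_congr rfl fun i _ => ?_
    rw [Finset.sum_comm]
    refine Finset.sum_congr rfl fun k _ => Finset.sum_congr rfl fun j _ => ?_
    ring
  have hQh : Q.IsHermitian := by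
    ext i j
    rw [Matrix.conjTranspose_apply, hQ, Matrix.of_apply, Matrix.of_apply, ← hPstar,
      Matrix.conjTranspose_single, star_one]
  have hQpos : Q.PosSemidef := by
    refine Matrix.PosSemidef.of_dotProduct_mulVec_nonneg hQh fun v => ?_
    have h1 := hPQ (Matrix.of fun (_ : Fin 1) i => v i)
    have h2 := hPpos (Matrix.of fun (_ : Fin 1) i => v i)
    rw [h1] at h2
    have h3 := hQh.im_star_dotProduct_mulVec_self v
    rw [Complex.le_def]
    simp at h2
    exact ⟨h2, h3.symm⟩
  -- A small multiple of the identity makes the density matrix `Q` invertible. Its trace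
  -- contribution `n δ` stays below `C`, and `n + 1` also covers `n = 0`.
  set δ : ℝ := C / (n + 1) with hδ
  have hδpos : 0 < δ := by positivity
  have hδn : n * δ ≤ C := by
    rw [hδ, mul_div_assoc', div_le_iff₀ (by positivity)]
    nlinarith
  have hpd : (Q + (δ : ℂ) • (1 : Matrix (Fin n) (Fin n) ℂ)).PosDef :=
    Matrix.PosDef.posSemidef_add hQpos (Matrix.PosDef.one.smul (by exact_mod_cast hδpos))
  obtain ⟨B, hB⟩ := CStarAlgebra.nonneg_iff_eq_star_mul_self.1 hpd.posSemidef.nonneg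
  rw [Matrix.star_eq_conjTranspose] at hB
  have hform : ∀ v : Fin n → ℂ, star v ⬝ᵥ (Q *ᵥ v) + δ * (star v ⬝ᵥ v)
      = ((∑ i, ‖(B *ᵥ v) i‖ ^ 2 : ℝ) : ℂ) := by
    intro v
    have h1 : star v ⬝ᵥ ((Q + (δ : ℂ) • (1 : Matrix (Fin n) (Fin n) ℂ)) *ᵥ v)
        = star (B *ᵥ v) ⬝ᵥ (B *ᵥ v) := by
      rw [hB, ← Matrix.mulVec_mulVec, Matrix.dotProduct_mulVec, Matrix.star_mulVec]
    rw [Matrix.add_mulVec, Matrix.smul_mulVec, Matrix.one_mulVec, dotProduct_add,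
      dotProduct_smul, smul_eq_mul] at h1
    rw [h1]
    simp [dotProduct, Complex.conj_mul']
  have hsum : ∀ {r : ℕ} (η : Matrix (Fin r) (Fin n) ℂ),
      (P (ηᴴ * η)).re + δ * hsNorm η ^ 2 = hsNorm (η * Bᵀ) ^ 2 := by
    intro r η
    have h1 : ((hsNorm (η * Bᵀ) ^ 2 : ℝ) : ℂ) = P (ηᴴ * η) + δ * (hsNorm η ^ 2 : ℝ) := by
      rw [hPQ, hsNorm_sq, hsNorm_sq, Complex.ofReal_sum, Complex.ofReal_sum, Finset.mul_sum,
        ← Finset.sum_add_distrib]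
      refine Finset.sum_congr rfl fun k _ => ?_
      have h2 := hform (η k)
      have h3 : star (η k) ⬝ᵥ (η k) = ((∑ j, ‖η k j‖ ^ 2 : ℝ) : ℂ) := by
        simp [dotProduct, Complex.conj_mul']
      rw [h3] at h2
      rw [h2]
      simp [Matrix.mul_apply, Matrix.mulVec, dotProduct, mul_comm]
    have h2 := congrArg Complex.re h1
    rw [Complex.ofReal_re, Complex.add_re, Complex.re_ofReal_mul, Complex.ofReal_re] at h2
    exact h2.symm
  refine ⟨B, ?_, ?_, fun r x η ξ hx => ?_⟩
  · have h1 := hpd.isUnit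
    rw [hB] at h1
    rw [Matrix.isUnit_iff_isUnit_det, Matrix.det_mul] at h1
    rw [Matrix.isUnit_iff_isUnit_det]
    exact isUnit_of_mul_isUnit_right h1
  -- At `η = 1` the identity reads `hsNorm B ^ 2 = P(1) + n δ`, and each term is at most `C`.
  · have h1 := hsum (1 : Matrix (Fin n) (Fin n) ℂ)
    rw [one_mul, hsNorm_transpose, Matrix.conjTranspose_one, one_mul, hsNorm_sq] at h1
    have h2 : ∑ i : Fin n, ∑ j : Fin n, ‖(1 : Matrix (Fin n) (Fin n) ℂ) i j‖ ^ 2 = n := by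
      simp [Matrix.one_apply, apply_ite (fun z : ℂ => ‖z‖ ^ 2)]
    rw [h2] at h1
    linarith
  · have h1 := hPf r x η ξ hx
    rw [map_add, Complex.add_re] at h1
    have h2 := hsum η
    have h3 := hsum ξ
    have h4 := mul_nonneg hδpos.le (sq_nonneg (hsNorm η))
    have h5 := mul_nonneg hδpos.le (sq_nonneg (hsNorm ξ))
    linarith

/-- Polarisation by scaling: the choice `s = b`, `t = a u`, with `u` the phase that makes `u z`
nonnegative, balances the two squares. Replacing `a`, `b` by `a + ε`, `b + ε` avoids dividing by
zero. -/
theorem norm_le_of_re_le {z : ℂ} {a b : ℝ} (ha : 0 ≤ a) (hb : 0 ≤ b)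
    (h : ∀ s t : ℂ, (star s * t * z).re ≤ ‖s‖ ^ 2 * a ^ 2 + ‖t‖ ^ 2 * b ^ 2) :
    ‖z‖ ≤ 2 * a * b := by
  obtain ⟨u, hu, huz⟩ : ∃ u : ℂ, ‖u‖ = 1 ∧ u * z = ‖z‖ := by
    rcases eq_or_ne z 0 with rfl | hz
    · exact ⟨1, by simp, by simp⟩
    · have hz' : (‖z‖ : ℂ) ≠ 0 := by simpa using hz
      refine ⟨‖z‖ / z, by simp [hz], by field_simp⟩
  have key : ∀ ε : ℝ, 0 < ε → ‖z‖ ≤ 2 * (a + ε) * (b + ε) := by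
    intro ε hε
    have h1 := h ((b + ε : ℝ) : ℂ) (((a + ε : ℝ) : ℂ) * u)
    have h2 : star (((b + ε : ℝ) : ℂ)) * (((a + ε : ℝ) : ℂ) * u) * z
        = (((b + ε) * (a + ε) * ‖z‖ : ℝ) : ℂ) := by
      rw [Complex.star_def, Complex.conj_ofReal]
      push_cast
      linear_combination ((b : ℂ) + ε) * (a + ε) * huz
    rw [h2, Complex.ofReal_re, norm_mul, hu, mul_one, Complex.norm_real, Complex.norm_real,
      Real.norm_of_nonneg (by positivity), Real.norm_of_nonneg (by positivity)] at h1
    have h3 : (b + ε) * (a + ε) * ‖z‖ ≤ (b + ε) * (a + ε) * (2 * (a + ε) * (b + ε)) := by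
      have h4 : a ^ 2 ≤ (a + ε) ^ 2 := by gcongr; linarith
      have h5 : b ^ 2 ≤ (b + ε) ^ 2 := by gcongr; linarith
      nlinarith [sq_nonneg (a + ε), sq_nonneg (b + ε)]
    exact le_of_mul_le_mul_left h3 (by positivity)
  have hlim : Filter.Tendsto (fun ε : ℝ => 2 * (a + ε) * (b + ε)) (nhdsWithin 0 (Set.Ioi 0))
      (nhds (2 * (a + 0) * (b + 0))) :=
    (Continuous.tendsto (by fun_prop) 0).mono_left nhdsWithin_le_nhds
  simpa using ge_of_tendsto hlim (Filter.eventually_of_mem self_mem_nhdsWithin key)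

/-- Ruan's factorization of a bounded functional on `M_n(V)` through `M_n(V^*)`. -/
theorem exists_isUnit_dualNorm_twist_le [OperatorSpace V] (F : Mat n (StrongDual ℂ V)) {C : ℝ}
    (hC : 0 < C) (hF : ∀ y, ‖pairing F y‖ ≤ C * mnorm n y) :
    ∃ B : Matrix (Fin n) (Fin n) ℂ, IsUnit B ∧ hsNorm B ^ 2 ≤ 2 * C ∧
      dualNorm (bimul B⁻¹ᴴ F B⁻¹) ≤ 2 := by
  obtain ⟨B, hB, hBC, hle⟩ := exists_isUnit_hsNorm_bound (pairing F) hC hF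
  refine ⟨B, hB, hBC, dualNorm_le_of_pairing _ zero_le_two fun r x η ξ hx => ?_⟩
  have hBB : (B⁻¹)ᵀ * Bᵀ = 1 := by
    rw [← Matrix.transpose_mul, Matrix.mul_nonsing_inv B ((Matrix.isUnit_iff_isUnit_det B).1 hB),
      Matrix.transpose_one]
  have h1 : bimul (B⁻¹ᴴ)ᵀ (bimul ηᴴ x ξ) (B⁻¹)ᵀ
      = bimul (η * (B⁻¹)ᵀ)ᴴ x (ξ * (B⁻¹)ᵀ) := by
    rw [bimul_bimul, Matrix.conjTranspose_mul]
    rfl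
  rw [pairing_bimul, h1]
  refine norm_le_of_re_le (hsNorm_nonneg η) (hsNorm_nonneg ξ) fun s t => ?_
  -- The twist by `B⁻¹` cancels the `Bᵀ` in the bound, leaving plain Hilbert-Schmidt norms of `η`
  -- and `ξ`.
  have h2 := hle r x (s • (η * (B⁻¹)ᵀ)) (t • (ξ * (B⁻¹)ᵀ)) hx
  rw [Matrix.conjTranspose_smul, smul_bimul_smul, map_smul, Matrix.smul_mul, Matrix.smul_mul,
    Matrix.mul_assoc, Matrix.mul_assoc, hBB, Matrix.mul_one, Matrix.mul_one, hsNorm_smul,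
    hsNorm_smul, mul_pow, mul_pow, smul_eq_mul] at h2
  exact h2

end Factorization

/-! ### Corners of 2 × 2 block matrices and a weighted corner norm -/

section Corners

variable {V : Type*} [AddCommGroup V] [Module ℂ V] {n : ℕ}

theorem bimul_inl_inl_block (a b c d : Mat n V) :
    bimul (inlScalar n n)ᴴ (block a b c d) (inlScalar n n) = a := by
  rw [inlScalar, conjTranspose_scalarCol, scalarRow_bimul_scalarCol]
  simp

theorem bimul_inl_inr_block (a b c d : Mat n V) :
    bimul (inlScalar n n)ᴴ (block a b c d) (inrScalar n n) = b := by
  rw [inlScalar, inrScalar, conjTranspose_scalarCol, scalarRow_bimul_scalarCol]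
  simp

theorem bimul_inr_inl_block (a b c d : Mat n V) :
    bimul (inrScalar n n)ᴴ (block a b c d) (inlScalar n n) = c := by
  rw [inlScalar, inrScalar, conjTranspose_scalarCol, scalarRow_bimul_scalarCol]
  simp

theorem bimul_inr_inr_block (a b c d : Mat n V) :
    bimul (inrScalar n n)ᴴ (block a b c d) (inrScalar n n) = d := by
  rw [inrScalar, conjTranspose_scalarCol, scalarRow_bimul_scalarCol]
  simp

theorem exists_eq_block (y : Mat (n + n) V) : ∃ a b c d : Mat n V, y = block a b c d := by
  refine ⟨Matrix.of fun i j => y (Fin.castAdd n i) (Fin.castAdd n j),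
    Matrix.of fun i j => y (Fin.castAdd n i) (Fin.natAdd n j),
    Matrix.of fun i j => y (Fin.natAdd n i) (Fin.castAdd n j),
    Matrix.of fun i j => y (Fin.natAdd n i) (Fin.natAdd n j), ?_⟩
  ext i j
  refine Fin.addCases (fun i => ?_) (fun i => ?_) i <;>
  refine Fin.addCases (fun j => ?_) (fun j => ?_) j <;>
  simp [block, -Fin.natAdd_eq_addNat]

theorem exists_eq_block_of_isHermitian [StarAddMonoid V] {y : Mat (n + n) V} (hy : y.IsHermitian) :
    ∃ a x d : Mat n V, y = block a x xᴴ d := by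
  obtain ⟨a, b, c, d, rfl⟩ := exists_eq_block y
  refine ⟨a, b, d, ?_⟩
  have h := hy.eq
  rw [conjTranspose_block] at h
  have h1 := congrArg (fun z => bimul (inrScalar n n)ᴴ z (inlScalar n n)) h
  simp only [bimul_inr_inl_block] at h1
  rw [h1]

end Corners

section CornerNorm

open OperatorSpace

variable {V : Type*} [NormedAddCommGroup V] [NormedSpace ℂ V] [OperatorSpace V] {m n : ℕ}

theorem mnorm_neg (x : Mat n V) : mnorm n (-x) = mnorm n x := by
  have := mnorm_smul n (-1) x
  simpa using this

/-- The weighted sum of the norms of the corners of a matrix in `M_{2n}(V)`. -/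
def cornerNorm (L : ℝ) (y : Mat (n + n) V) : ℝ :=
  mnorm n (bimul (inlScalar n n)ᴴ y (inlScalar n n))
    + mnorm n (bimul (inrScalar n n)ᴴ y (inrScalar n n))
    + L * (mnorm n (bimul (inlScalar n n)ᴴ y (inrScalar n n))
      + mnorm n (bimul (inrScalar n n)ᴴ y (inlScalar n n)))

theorem cornerNorm_block (L : ℝ) (a b c d : Mat n V) :
    cornerNorm L (block a b c d) = mnorm n a + mnorm n d + L * (mnorm n b + mnorm n c) := by
  simp only [cornerNorm, bimul_inl_inl_block, bimul_inl_inr_block, bimul_inr_inl_block,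
    bimul_inr_inr_block]

theorem cornerNorm_smul (L : ℝ) (c : ℂ) (y : Mat (n + n) V) :
    cornerNorm L (c • y) = ‖c‖ * cornerNorm L y := by
  simp only [cornerNorm, bimul_smul, mnorm_smul]
  ring

theorem cornerNorm_add_le {L : ℝ} (hL : 0 ≤ L) (x y : Mat (n + n) V) :
    cornerNorm L (x + y) ≤ cornerNorm L x + cornerNorm L y := by
  obtain ⟨a, b, c, d, rfl⟩ := exists_eq_block x
  obtain ⟨a', b', c', d', rfl⟩ := exists_eq_block y
  rw [block_add, cornerNorm_block, cornerNorm_block, cornerNorm_block]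
  have h1 := mnorm_add_le n a a'
  have h2 := mnorm_add_le n d d'
  have h3 := mul_le_mul_of_nonneg_left
    (add_le_add (mnorm_add_le n b b') (mnorm_add_le n c c')) hL
  linarith

theorem cornerNorm_nonneg {L : ℝ} (hL : 0 ≤ L) (y : Mat (n + n) V) : 0 ≤ cornerNorm L y := by
  obtain ⟨a, b, c, d, rfl⟩ := exists_eq_block y
  rw [cornerNorm_block]
  have h1 := mnorm_nonneg n a
  have h2 := mnorm_nonneg n b
  have h3 := mnorm_nonneg n c
  have h4 := mnorm_nonneg n d
  positivity

theorem mnorm_bimul_le_of_le_one {α : Matrix (Fin n) (Fin m) ℂ} {β : Matrix (Fin m) (Fin n) ℂ}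
    (hα : ‖α‖ ≤ 1) (hβ : ‖β‖ ≤ 1) (x : Mat m V) : mnorm n (bimul α x β) ≤ mnorm m x := by
  have hx := mnorm_nonneg m x
  calc _ ≤ ‖α‖ * mnorm m x * ‖β‖ := mnorm_bimul_le _ _ _ _ _
    _ ≤ 1 * mnorm m x * 1 := by gcongr
    _ = _ := by ring

theorem cornerNorm_le {L : ℝ} (hL : 0 ≤ L) (y : Mat (n + n) V) :
    cornerNorm L y ≤ (2 + 2 * L) * mnorm (n + n) y := by
  have h1 := norm_inlScalar_le (m := n) (n := n)
  have h2 := norm_inrScalar_le (m := n) (n := n)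
  have h1' := h1
  have h2' := h2
  rw [← Matrix.l2_opNorm_conjTranspose] at h1' h2'
  have h3 := mnorm_bimul_le_of_le_one h1' h1 y
  have h4 := mnorm_bimul_le_of_le_one h2' h2 y
  have h5 := mul_le_mul_of_nonneg_left (add_le_add (mnorm_bimul_le_of_le_one h1' h2 y)
    (mnorm_bimul_le_of_le_one h2' h1 y)) hL
  rw [cornerNorm]
  linarith

theorem mnorm_single_le (i j : Fin n) (v : V) : mnorm n (Matrix.single i j v) ≤ ‖v‖ := by
  have h1 : Matrix.single i j v
      = bimul (Matrix.of fun a (_ : Fin 1) => (EuclideanSpace.single i (1 : ℂ)) a)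
        (Matrix.of fun (_ _ : Fin 1) => v)
        (Matrix.of fun (_ : Fin 1) a => star ((EuclideanSpace.single j (1 : ℂ)) a)) := by
    ext a b
    simp [bimul, Matrix.single_apply, apply_ite (starRingEnd ℂ), ite_and, eq_comm]
    split_ifs <;> simp_all
  rw [h1, ← mnorm_one v]
  refine mnorm_bimul_le_of_le_one ((norm_col_le _).trans ?_) ((norm_row_le _).trans ?_) _ <;> simp

/-- Restricting `G` to each matrix unit position gives its entries; the bound on `G` makes them
continuous. -/
theorem exists_pairing_eq (G : Mat n V →ₗ[ℂ] ℂ) {C : ℝ} (hG : ∀ y, ‖G y‖ ≤ C * mnorm n y) :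
    ∃ F : Mat n (StrongDual ℂ V), pairing F = G := by
  have hC : ∀ (i j : Fin n) (v : V), ‖G (Matrix.single i j v)‖ ≤ |C| * ‖v‖ := fun i j v =>
    (hG _).trans ((mul_le_mul_of_nonneg_right (le_abs_self C) (mnorm_nonneg _ _)).trans
      (mul_le_mul_of_nonneg_left (mnorm_single_le i j v) (abs_nonneg C)))
  refine ⟨Matrix.of fun i j => LinearMap.mkContinuous
    { toFun := fun v => G (Matrix.single i j v)
      map_add' := fun v w => by rw [Matrix.single_add, map_add]
      map_smul' := fun c v => by rw [← Matrix.smul_single, map_smul, RingHom.id_apply] }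
    |C| (hC i j), ?_⟩
  ext y
  conv_rhs => rw [Matrix.matrix_eq_sum_single y]
  simp [pairing_apply]

theorem pairing_block (A B C D : Mat n (StrongDual ℂ V)) (a b c d : Mat n V) :
    pairing (block A B C D) (block a b c d)
      = pairing A a + pairing B b + pairing C c + pairing D d := by
  simp [pairing_apply, block, Fin.sum_univ_add, Finset.sum_add_distrib, -Fin.natAdd_eq_addNat]
  ring

end CornerNorm

/-! ### Approximate domination, from the operator system structure of the dual -/

section Generation

open OperatorSpace MatrixOrdered MatrixOrderedOperatorSpace

variable {V : Type*} [NormedAddCommGroup V] [NormedSpace ℂ V] [StarAddMonoid V]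
  [StarModule ℂ V] [MatrixOrderedOperatorSpace V] {n : ℕ}

theorem cornerNorm_conjTranspose (L : ℝ) (y : Mat (n + n) V) :
    cornerNorm L yᴴ = cornerNorm L y := by
  obtain ⟨a, b, c, d, rfl⟩ := exists_eq_block y
  rw [conjTranspose_block, cornerNorm_block, cornerNorm_block]
  simp only [mnorm_conjTranspose]
  ring

/-- A positive `φ` is nonnegative at both `[a x; x* d]` and `[a -x; -x* d]`, so its value at `[0 x;
x* 0]` is real and bounded in modulus by `φ(a ⊕ d)`. It is applied to `V` and to its dual, with
opposite purposes. -/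
theorem IsDominated.numRadius_le {a x d : Mat n V} (h : IsDominated a x d) :
    numRadius x ≤ max (mnorm n a) (mnorm n d) := by
  refine Real.sSup_le ?_ (le_max_of_le_left (mnorm_nonneg n a))
  rintro r ⟨φ, ⟨hφ1, -, hφ3⟩, rfl⟩
  have h1 := hφ3 _ h
  have h2 := hφ3 _ h.neg
  have e1 : block a x xᴴ d = block a 0 0 d + block 0 x xᴴ 0 := by
    rw [block_add]; simp
  have e2 : block a (-x) (-x)ᴴ d = block a 0 0 d + (-1 : ℂ) • block 0 x xᴴ 0 := by
    rw [smul_block, block_add]; simp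
  rw [e1, map_add] at h1
  rw [e2, map_add, map_smul, smul_eq_mul] at h2
  have h3 := hφ1 (block a 0 0 d)
  rw [mnorm_block] at h3
  refine le_trans ?_ h3
  rw [Complex.le_def] at h1 h2
  simp only [Complex.zero_re, Complex.zero_im, Complex.add_re, Complex.add_im, neg_mul, one_mul,
    Complex.neg_re, Complex.neg_im] at h1 h2
  have him : (φ (block 0 x xᴴ 0)).im = 0 := by linarith [h1.2, h2.2]
  have h4 : φ (block 0 x xᴴ 0) = ((φ (block 0 x xᴴ 0)).re : ℂ) := by
    apply Complex.ext <;> simp [him]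
  rw [h4, Complex.norm_real, Real.norm_eq_abs]
  exact (abs_le.2 ⟨by linarith [h1.1], by linarith [h2.1]⟩).trans (Complex.re_le_norm _)

variable [NormedStarGroup V]

/-- If `x` is at weighted distance at least `c` from the dominated elements, then Hahn-Banach and
the comparison of norms in the dual space bound `c` by the norm of `x`. -/
theorem le_mnorm_of_forall_isDominated {k : ℝ}
    (hk : ∀ (n : ℕ) (F : Mat n (StrongDual ℂ V)), mnorm n F ≤ k * numRadius F) (hk0 : 0 < k)
    {L : ℝ} (hL : 0 ≤ L) {c : ℝ} (x : Mat n V)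
    (h : ∀ a y d : Mat n V, IsDominated a y d →
      c ≤ mnorm n a + mnorm n d + 2 * L * mnorm n (y + x)) :
    c ≤ 16 * k * mnorm n x := by
  set o : Mat (n + n) V := block 0 x xᴴ 0 with ho
  have hoh : oᴴ = o := by rw [ho, conjTranspose_block]; simp
  have hPo : ∀ P ∈ cone (n + n), c ≤ cornerNorm L (P + o) := by
    intro P hP
    obtain ⟨a, y, d, rfl⟩ := exists_eq_block_of_isHermitian (cone_isHermitian _ _ hP)
    rw [ho, block_add, cornerNorm_block, add_zero, add_zero, ← Matrix.conjTranspose_add,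
      mnorm_conjTranspose]
    have := h a y d hP
    linarith
  -- The cone encodes two lower constraints on `ψ`: `ψ ≥ 0` on positive matrices (`t = 0`) and `ψ o
  -- ≥ c` (`P = 0`, `t = 1`).
  let K : ConvexCone ℝ (Mat (n + n) V × ℝ) :=
    { carrier := {p | ∃ P ∈ cone (n + n), ∃ t : ℝ, 0 ≤ t ∧ p = (P + (t : ℂ) • o, t * c)}
      smul_mem' := by
        rintro s hs _ ⟨P, hP, t, ht, rfl⟩
        refine ⟨(s : ℂ) • P, cone_smul _ s _ hs.le hP, s * t, by positivity, ?_⟩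
        refine Prod.ext ?_ ?_
        · simp [mul_smul]
        · simp [mul_assoc]
      add_mem' := by
        rintro _ ⟨P, hP, t, ht, rfl⟩ _ ⟨Q, hQ, s, hs, rfl⟩
        refine ⟨P + Q, cone_add _ _ _ hP hQ, t + s, by positivity, ?_⟩
        refine Prod.ext ?_ ?_
        · simp only [Prod.mk_add_mk, Complex.ofReal_add, add_smul]; abel
        · simp only [Prod.mk_add_mk]; ring }
  have hcs : ∀ (s : ℝ), 0 < s → ∀ y : Mat (n + n) V,
      cornerNorm L (s • y) = s * cornerNorm L y := fun s hs y => by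
    rw [← Complex.coe_smul, cornerNorm_smul, Complex.norm_real, Real.norm_of_nonneg hs.le]
  obtain ⟨ψ, hψN, hψK⟩ := exists_linearMap_between (cornerNorm L) hcs (cornerNorm_add_le hL) K
    ⟨0, cone_zero _, 0, le_rfl, Prod.ext (by simp) (by simp)⟩ (by
      rintro _ ⟨P, hP, t, ht, rfl⟩
      simp only
      rcases ht.eq_or_lt with rfl | ht
      · simpa using cornerNorm_nonneg hL P
      · have h1 := hPo _ (cone_smul _ t⁻¹ _ (inv_pos.2 ht).le hP)
        have h2 : P + (t : ℂ) • o = t • (((t⁻¹ : ℝ) : ℂ) • P + o) := by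
          rw [smul_add, Complex.coe_smul, Complex.coe_smul, smul_smul, mul_inv_cancel₀ ht.ne',
            one_smul]
        rw [h2, hcs t ht]
        exact mul_le_mul_of_nonneg_left h1 ht.le)
  have hψpos : ∀ P ∈ cone (n + n), 0 ≤ ψ P := fun P hP => by
    simpa using hψK _ ⟨P, hP, 0, le_rfl, rfl⟩
  have hψo : c ≤ ψ o := by
    simpa using hψK _ ⟨0, cone_zero _, 1, zero_le_one, rfl⟩
  obtain ⟨G, hGstar, hGh, hGre⟩ := exists_selfAdjoint_extension ψ
  have hψabs : ∀ y, |ψ y| ≤ cornerNorm L y := fun y => by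
    refine abs_le.2 ⟨?_, hψN y⟩
    have h1 := hψN (-y)
    have h2 := cornerNorm_smul L (-1) y
    rw [neg_one_smul, norm_neg, norm_one, one_mul] at h2
    rw [h2, map_neg] at h1
    linarith
  have hGre' : ∀ y, |(G y).re| ≤ cornerNorm L y := fun y => by
    have h1 := hψabs y
    have h2 := hψabs (star y)
    rw [Matrix.star_eq_conjTranspose, cornerNorm_conjTranspose,
      ← Matrix.star_eq_conjTranspose] at h2
    rw [hGre, abs_le]
    rw [abs_le] at h1 h2
    constructor <;> linarith [h1.1, h1.2, h2.1, h2.2]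
  -- The factor 2 comes from bounding real and imaginary parts separately.
  have hGN : ∀ y, ‖G y‖ ≤ 2 * cornerNorm L y := fun y => by
    have h1 := hGre' y
    have h2 := hGre' (Complex.I • y)
    rw [map_smul, cornerNorm_smul, Complex.norm_I, one_mul, smul_eq_mul, Complex.I_mul_re,
      abs_neg] at h2
    exact (Complex.norm_le_abs_re_add_abs_im _).trans (by linarith)
  obtain ⟨Γ, hΓ⟩ := exists_pairing_eq G (C := 2 * (2 + 2 * L)) fun y =>
    (hGN y).trans (by have := cornerNorm_le hL y; linarith)
  have hΓcone : Γ ∈ cone (n + n) := by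
    refine mem_dualCone_of_pairing Γ (fun y => ?_) fun y hy => ?_
    · rw [hΓ]; exact hGstar y
    · rw [hΓ, hGh y (cone_isHermitian _ _ hy)]
      exact_mod_cast hψpos y hy
  obtain ⟨A, F, D, rfl⟩ := exists_eq_block_of_isHermitian (cone_isHermitian _ _ hΓcone)
  have hdom : IsDominated A F D := hΓcone
  -- Diagonal corners have weight 1 in the corner norm, so the bounds on `A` and `D` do not involve
  -- `L`.
  have hA : ∀ z, ‖pairing A z‖ ≤ 2 * mnorm n z := fun z => by
    have h1 := hGN (block z 0 0 0)
    rw [← hΓ, pairing_block, cornerNorm_block] at h1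
    simpa [mnorm_zero] using h1
  have hD : ∀ z, ‖pairing D z‖ ≤ 2 * mnorm n z := fun z => by
    have h1 := hGN (block 0 0 0 z)
    rw [← hΓ, pairing_block, cornerNorm_block] at h1
    simpa [mnorm_zero] using h1
  obtain ⟨B, hB, hB4, hA2⟩ := exists_isUnit_dualNorm_twist_le A two_pos hA
  obtain ⟨T, hT, hT4, hD2⟩ := exists_isUnit_dualNorm_twist_le D two_pos hD
  rw [Matrix.isUnit_iff_isUnit_det] at hB hT
  -- Conjugation by `B⁻¹ ⊕ T⁻¹` keeps the block matrix positive and makes its diagonal bounded in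
  -- cb-norm, where the operator system inequality of the dual applies.
  set F' := bimul B⁻¹ᴴ F T⁻¹ with hF'
  have hF'2 : dualNorm F' ≤ 2 * k := by
    have h1 := hdom.bimul B⁻¹ᴴ T⁻¹
    rw [Matrix.conjTranspose_conjTranspose] at h1
    have h2 : numRadius F' ≤ 2 := h1.numRadius_le.trans (max_le hA2 hD2)
    calc dualNorm F' ≤ k * numRadius F' := hk n F'
      _ ≤ k * 2 := by gcongr
      _ = _ := by ring
  have hFF' : F = bimul Bᴴ F' T := by
    rw [hF', bimul_bimul, ← Matrix.conjTranspose_mul, Matrix.nonsing_inv_mul B hB,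
      Matrix.nonsing_inv_mul T hT, Matrix.conjTranspose_one, one_bimul_one]
  -- The constant is `2k` for `F'` times the Hilbert-Schmidt norms of `B` and `T`, each at most 2.
  have hFx : ‖pairing F x‖ ≤ 8 * k * mnorm n x := by
    rw [hFF', pairing_bimul]
    have h1 := norm_pairing_bimul_le F' x Bᵀ Tᵀ
    rw [hsNorm_transpose, hsNorm_transpose] at h1
    have hB2 : hsNorm B ≤ 2 := by nlinarith [hsNorm_nonneg B]
    have hT2 : hsNorm T ≤ 2 := by nlinarith [hsNorm_nonneg T]
    have hx := mnorm_nonneg n x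
    refine h1.trans ?_
    have hB0 := hsNorm_nonneg B
    have hT0 := hsNorm_nonneg T
    calc dualNorm F' * mnorm n x * hsNorm B * hsNorm T
        ≤ (2 * k) * mnorm n x * 2 * 2 := by gcongr
      _ = _ := by ring
  have hGo : G o = G (block 0 x 0 0) + star (G (block 0 x 0 0)) := by
    rw [← hGstar, ← map_add, Matrix.star_eq_conjTranspose, conjTranspose_block, block_add, ho]
    simp
  have hGx : G (block 0 x 0 0) = pairing F x := by
    rw [← hΓ, pairing_block]; simp
  have h1 : ‖G o‖ ≤ 16 * k * mnorm n x := by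
    rw [hGo, hGx]
    refine (norm_add_le _ _).trans ?_
    rw [norm_star]
    linarith
  have h2 : G o = ψ o := hGh o hoh
  rw [h2, Complex.norm_real] at h1
  exact hψo.trans ((le_abs_self _).trans h1)

/-- If no triple works, then for every dominated `y` one of `‖a‖`, `‖d‖`, `2L ‖x - y‖` with `L =
17k` exceeds `17k ‖x‖`. This contradicts `le_mnorm_of_forall_isDominated`, whose constant is only
`16k`. -/
theorem exists_isDominated_near (hdual : IsOperatorSystem (StrongDual ℂ V)) :
    ∃ C : ℝ, 0 < C ∧ ∀ (n : ℕ) (x : Mat n V), ∃ a y d : Mat n V, IsDominated a y d ∧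
      mnorm n a ≤ C * mnorm n x ∧ mnorm n d ≤ C * mnorm n x ∧
      mnorm n (x - y) ≤ 1 / 2 * mnorm n x := by
  obtain ⟨k, hk0, hk⟩ := hdual.dominated
  refine ⟨17 * k, by positivity, fun n x => ?_⟩
  rcases (mnorm_nonneg n x).eq_or_lt with hx | hx
  · have : x = 0 := eq_zero_of_mnorm n x hx.symm
    subst this
    exact ⟨0, 0, 0, IsDominated.zero, by simp [mnorm_zero]⟩
  · by_contra! hcon
    have h := le_mnorm_of_forall_isDominated hk hk0 (L := 17 * k) (by positivity)
      (c := 17 * k * mnorm n x) (-x) fun a y d hd => by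
        by_contra! hlt
        have ha := mnorm_nonneg n a
        have hd' := mnorm_nonneg n d
        have hy := mnorm_nonneg n (y + -x)
        have hky : 0 ≤ 2 * (17 * k) * mnorm n (y + -x) := by positivity
        have h1 := hcon a y d hd (by linarith) (by linarith)
        have h2 : mnorm n (x - y) = mnorm n (y + -x) := by
          rw [← mnorm_neg]; congr 1; abel
        rw [h2] at h1
        nlinarith
    rw [mnorm_neg] at h
    nlinarith [mul_pos hk0 hx]

end Generation

/-! ### Matrix norms and entrywise convergence -/

section Topology

open OperatorSpace

variable {V : Type*} [NormedAddCommGroup V] [NormedSpace ℂ V] [OperatorSpace V] {n : ℕ}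

theorem mnorm_sum_le {ι : Type*} (s : Finset ι) (f : ι → Mat n V) :
    mnorm n (∑ i ∈ s, f i) ≤ ∑ i ∈ s, mnorm n (f i) := by
  induction s using Finset.cons_induction with
  | empty => simp [mnorm_zero]
  | cons a s ha ih =>
    rw [Finset.sum_cons, Finset.sum_cons]
    exact (mnorm_add_le _ _ _).trans (by gcongr)

theorem mnorm_le_sum_norm (y : Mat n V) : mnorm n y ≤ ∑ i, ∑ j, ‖y i j‖ := by
  conv_lhs => rw [Matrix.matrix_eq_sum_single y]
  refine (mnorm_sum_le _ _).trans (Finset.sum_le_sum fun i _ => ?_)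
  exact (mnorm_sum_le _ _).trans (Finset.sum_le_sum fun j _ => mnorm_single_le i j _)

theorem norm_apply_le_mnorm (y : Mat n V) (i j : Fin n) : ‖y i j‖ ≤ mnorm n y := by
  have h1 : (Matrix.of fun (_ _ : Fin 1) => y i j)
      = bimul (Matrix.of fun (_ : Fin 1) a => star ((EuclideanSpace.single i (1 : ℂ)) a)) y
        (Matrix.of fun a (_ : Fin 1) => (EuclideanSpace.single j (1 : ℂ)) a) := by
    ext a b
    simp [bimul, apply_ite (starRingEnd ℂ), ite_and]
  rw [← mnorm_one, h1]
  refine mnorm_bimul_le_of_le_one ((norm_row_le _).trans ?_) ((norm_col_le _).trans ?_) _ <;> simp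

/-- Continuity is for the entrywise topology on matrices: `mnorm` is subadditive and at most the sum
of the norms of the entries. -/
theorem continuous_mnorm : Continuous (mnorm n : Mat n V → ℝ) := by
  refine continuous_iff_continuousAt.2 fun x => ?_
  rw [ContinuousAt, tendsto_iff_norm_sub_tendsto_zero]
  have hlim : Filter.Tendsto (fun y : Mat n V => ∑ i, ∑ j, ‖(y - x) i j‖) (nhds x) (nhds 0) := by
    have hc : Continuous fun y : Mat n V => ∑ i, ∑ j, ‖(y - x) i j‖ := by
      simp only [Matrix.sub_apply]
      fun_prop
    simpa using hc.tendsto x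
  refine squeeze_zero (fun _ => norm_nonneg _) (fun y => ?_) hlim
  refine le_trans ?_ (mnorm_le_sum_norm (y - x))
  have h1 := mnorm_add_le n (y - x) x
  have h2 := mnorm_add_le n (x - y) y
  have h3 : mnorm n (x - y) = mnorm n (y - x) := by rw [← mnorm_neg, neg_sub]
  rw [sub_add_cancel] at h1 h2
  rw [Real.norm_eq_abs, abs_le]
  constructor <;> linarith

theorem isClosed_cone {V : Type*} [NormedAddCommGroup V] [NormedSpace ℂ V] [StarAddMonoid V]
    [StarModule ℂ V] [MatrixOrderedOperatorSpace V] :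
    IsClosed (MatrixOrdered.cone n : Set (Mat n V)) := by
  refine isClosed_of_closure_subset fun x hx => ?_
  refine MatrixOrderedOperatorSpace.cone_closed n x fun ε hε => ?_
  have hc : Continuous fun y : Mat n V => mnorm n (x - y) :=
    continuous_mnorm.comp (continuous_const.sub continuous_id)
  have ho : IsOpen {y : Mat n V | mnorm n (x - y) < ε} := isOpen_lt hc continuous_const
  obtain ⟨y, hy1, hy2⟩ := mem_closure_iff.1 hx _ ho (by simpa [mnorm_zero] using hε)
  exact ⟨y, hy2, hy1⟩

end Topology

/-! ### From approximate to exact domination -/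

section Complete

open OperatorSpace MatrixOrdered

variable {V : Type*} [NormedAddCommGroup V] [NormedSpace ℂ V] [StarAddMonoid V]
  [StarModule ℂ V] [MatrixOrderedOperatorSpace V] [NormedStarGroup V] [CompleteSpace V]

theorem exists_tendsto_sum_of_mnorm_le {n : ℕ} (a : ℕ → Mat n V) {M : ℝ}
    (h : ∀ i, mnorm n (a i) ≤ M * (1 / 2) ^ i) :
    ∃ s : Mat n V, Filter.Tendsto (fun N => ∑ i ∈ Finset.range N, a i) Filter.atTop (nhds s) ∧
      mnorm n s ≤ M * 2 := by
  have hs : Summable a := by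
    refine Pi.summable.2 fun p => Pi.summable.2 fun q => ?_
    exact Summable.of_norm_bounded (summable_geometric_two.mul_left M) fun i =>
      (norm_apply_le_mnorm (a i) p q).trans (h i)
  refine ⟨_, hs.hasSum.tendsto_sum_nat, ?_⟩
  refine le_of_tendsto ((continuous_mnorm.tendsto _).comp hs.hasSum.tendsto_sum_nat)
    (Filter.Eventually.of_forall fun N => ?_)
  have hM : 0 ≤ M := by simpa using (mnorm_nonneg n (a 0)).trans (h 0)
  calc mnorm n (∑ i ∈ Finset.range N, a i) ≤ ∑ i ∈ Finset.range N, M * (1 / 2 : ℝ) ^ i :=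
        (mnorm_sum_le _ _).trans (Finset.sum_le_sum fun i _ => h i)
    _ = M * ∑ i ∈ Finset.range N, (1 / 2 : ℝ) ^ i := by rw [Finset.mul_sum]
    _ ≤ M * 2 := mul_le_mul_of_nonneg_left (sum_geometric_two_le N) hM

/-- Approximate domination is applied repeatedly to the error, which halves each time. The dominated
parts add up to `x`, the dominating ones converge by completeness, and closedness of the cone
preserves positivity in the limit. -/
theorem exists_isDominated (hdual : IsOperatorSystem (StrongDual ℂ V)) :
    ∃ C : ℝ, 0 < C ∧ ∀ (n : ℕ) (x : Mat n V), ∃ a d : Mat n V, IsDominated a x d ∧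
      mnorm n a ≤ C * mnorm n x ∧ mnorm n d ≤ C * mnorm n x := by
  obtain ⟨C, hC, hnear⟩ := exists_isDominated_near hdual
  refine ⟨C * 2, by positivity, fun n x => ?_⟩
  choose a y d hdom ha hd hy using hnear n
  -- The successive errors, `X (i + 1) = X i - y (X i)`.
  set X : ℕ → Mat n V := fun i => (fun z => z - y z)^[i] x with hX
  have hXs : ∀ i, X (i + 1) = X i - y (X i) := fun i => by
    rw [hX]; exact Function.iterate_succ_apply' _ _ _
  have hXn : ∀ i, mnorm n (X i) ≤ mnorm n x * (1 / 2) ^ i := by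
    intro i
    induction i with
    | zero => simp [hX]
    | succ i ih =>
      rw [hXs, pow_succ]
      have := hy (X i)
      linarith
  have hbound : ∀ {b : Mat n V → Mat n V}, (∀ z, mnorm n (b z) ≤ C * mnorm n z) →
      ∀ i, mnorm n (b (X i)) ≤ C * mnorm n x * (1 / 2) ^ i := by
    intro b hb i
    refine (hb _).trans ?_
    rw [mul_assoc]
    exact mul_le_mul_of_nonneg_left (hXn i) hC.le
  obtain ⟨sa, hsa, hsa'⟩ := exists_tendsto_sum_of_mnorm_le (fun i => a (X i)) (hbound ha)
  obtain ⟨sd, hsd, hsd'⟩ := exists_tendsto_sum_of_mnorm_le (fun i => d (X i)) (hbound hd)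
  have hsum : ∀ N, ∑ i ∈ Finset.range N, y (X i) = x - X N := by
    intro N
    induction N with
    | zero => simp [hX]
    | succ N ih => rw [Finset.sum_range_succ, ih, hXs]; abel
  have hX0 : Filter.Tendsto X Filter.atTop (nhds 0) := by
    refine tendsto_pi_nhds.2 fun p => tendsto_pi_nhds.2 fun q => ?_
    refine squeeze_zero_norm (fun i => (norm_apply_le_mnorm (X i) p q).trans (hXn i)) ?_
    simpa using (tendsto_pow_atTop_nhds_zero_of_lt_one (by norm_num : (0 : ℝ) ≤ 1 / 2)
      (by norm_num)).const_mul (mnorm n x)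
  have hsy : Filter.Tendsto (fun N => ∑ i ∈ Finset.range N, y (X i)) Filter.atTop (nhds x) := by
    simp only [hsum]
    simpa using hX0.const_sub x
  refine ⟨sa, sd, ?_, by linarith, by linarith⟩
  have hpart : ∀ N, IsDominated (∑ i ∈ Finset.range N, a (X i)) (∑ i ∈ Finset.range N, y (X i))
      (∑ i ∈ Finset.range N, d (X i)) := by
    intro N
    induction N with
    | zero => simpa using IsDominated.zero
    | succ N ih =>
      simp only [Finset.sum_range_succ]
      exact ih.add (hdom (X N))
  have hcont : Continuous fun p : Mat n V × Mat n V × Mat n V => block p.1 p.2.1 p.2.1ᴴ p.2.2 := by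
    unfold block
    have hst : Continuous fun v : V => star v := by
      have : Isometry (fun v : V => star v) := AddMonoidHomClass.isometry_of_norm
        (starAddEquiv : V ≃+ V) norm_star
      exact this.continuous
    have hct : Continuous fun p : Mat n V × Mat n V × Mat n V => p.2.1ᴴ :=
      continuous_matrix fun i j => hst.comp (by fun_prop)
    exact (Continuous.matrix_fromBlocks (by fun_prop) (by fun_prop) hct
      (by fun_prop)).matrix_submatrix _ _
  exact isClosed_cone.mem_of_tendsto
    ((hcont.tendsto (sa, x, sd)).comp (hsa.prodMk_nhds (hsy.prodMk_nhds hsd)))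
    (Filter.Eventually.of_forall hpart)

end Complete

/-! ### The regular norm -/

section RegularNorm

open OperatorSpace MatrixOrdered MatrixOrderedOperatorSpace

/-- Conjugation by `√s ⊕ 1/√s` leaves the off-diagonal corner fixed, so the sizes of `a` and `d` can
be traded against each other. -/
theorem IsDominated.rescale {V : Type*} [AddCommGroup V] [Module ℂ V] [StarAddMonoid V]
    [StarModule ℂ V] [MatrixOrdered V] {n : ℕ} {a x d : Mat n V} (h : IsDominated a x d) {s : ℝ}
    (hs : 0 < s) : IsDominated ((s : ℂ) • a) x (((s⁻¹ : ℝ) : ℂ) • d) := by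
  have hr : Real.sqrt s ≠ 0 := (Real.sqrt_pos.2 hs).ne'
  have h1 := h.bimul (((Real.sqrt s : ℝ) : ℂ) • (1 : Matrix (Fin n) (Fin n) ℂ))
    ((((Real.sqrt s)⁻¹ : ℝ) : ℂ) • 1)
  simp only [Matrix.conjTranspose_smul, Matrix.conjTranspose_one, smul_bimul_smul,
    Complex.star_def, Complex.conj_ofReal, one_bimul_one, ← Complex.ofReal_mul,
    mul_inv_cancel₀ hr, ← mul_inv, Real.mul_self_sqrt hs.le] at h1
  simpa using h1

variable (V : Type*) [NormedAddCommGroup V] [NormedSpace ℂ V] [StarAddMonoid V]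
  [StarModule ℂ V] [MatrixOrderedOperatorSpace V]

/-- The cones are uniformly generating, and domination controls the norm uniformly. -/
class IsRegularizable : Prop where
  mnorm_le : ∃ k : ℝ, 0 < k ∧ ∀ (n : ℕ) (a x d : Mat n V), IsDominated a x d →
    mnorm n x ≤ k * max (mnorm n a) (mnorm n d)
  generating : ∃ C : ℝ, 0 < C ∧ ∀ (n : ℕ) (x : Mat n V), ∃ a d : Mat n V, IsDominated a x d ∧
    mnorm n a ≤ C * mnorm n x ∧ mnorm n d ≤ C * mnorm n x

variable {V} {m n : ℕ}

/-- The regular norm `inf {max ‖a‖ ‖d‖ : [a x; x* d] ≥ 0}`. -/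
def regNorm (x : Mat n V) : ℝ :=
  sInf {t | ∃ a d : Mat n V, IsDominated a x d ∧ mnorm n a ≤ t ∧ mnorm n d ≤ t}

theorem regNorm_nonneg (x : Mat n V) : 0 ≤ regNorm x := by
  refine Real.sInf_nonneg ?_
  rintro t ⟨a, d, -, ha, -⟩
  exact (mnorm_nonneg n a).trans ha

theorem IsDominated.regNorm_le {a x d : Mat n V} (h : IsDominated a x d) {t : ℝ}
    (ha : mnorm n a ≤ t) (hd : mnorm n d ≤ t) : regNorm x ≤ t := by
  refine csInf_le ⟨0, ?_⟩ ⟨a, d, h, ha, hd⟩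
  rintro s ⟨a, d, -, ha, -⟩
  exact (mnorm_nonneg n a).trans ha

theorem regNorm_zero : regNorm (0 : Mat n V) = 0 :=
  le_antisymm (IsDominated.zero.regNorm_le (mnorm_zero n).le (mnorm_zero n).le) (regNorm_nonneg _)

theorem regNorm_conjTranspose (x : Mat n V) : regNorm xᴴ = regNorm x := by
  unfold regNorm
  congr 1
  ext t
  constructor
  · rintro ⟨a, d, h, ha, hd⟩
    exact ⟨d, a, by simpa using h.conjTranspose, hd, ha⟩
  · rintro ⟨a, d, h, ha, hd⟩
    exact ⟨d, a, h.conjTranspose, hd, ha⟩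

/-- Regularity: order intervals `[-u, u]` are bounded by `u`. -/
theorem IsDominated.regNorm_le_of_le {a u d v : Mat n V} (hu : u.IsHermitian)
    (h : IsDominated a u d) (hv : v.IsHermitian) (h1 : v + u ∈ cone n) (h2 : u - v ∈ cone n)
    {t : ℝ} (ha : mnorm n a ≤ t) (hd : mnorm n d ≤ t) : regNorm v ≤ t := by
  -- Here `±v ≤ u ≤ c`, so `v` is dominated by `c` on both sides.
  set c : Mat n V := (1 / 2 : ℂ) • (a + d) with hc
  have h3 : c - u ∈ cone n := h.add_sub_mem hu
  have h4 : IsDominated c v c := by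
    refine IsDominated.of_le hv ?_ ?_
    · have := cone_add _ _ _ h1 h3
      rwa [show v + u + (c - u) = v + c by abel] at this
    · have := cone_add _ _ _ h2 h3
      rwa [show u - v + (c - u) = c - v by abel] at this
  have h5 : mnorm n c ≤ t := by
    rw [hc, mnorm_smul]
    have := mnorm_add_le n a d
    norm_num
    linarith
  exact h4.regNorm_le h5 h5

variable [IsRegularizable V]

theorem exists_isDominated_of_regNorm_lt {x : Mat n V} {t : ℝ} (h : regNorm x < t) :
    ∃ a d : Mat n V, IsDominated a x d ∧ mnorm n a < t ∧ mnorm n d < t := by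
  obtain ⟨C, -, hC⟩ := IsRegularizable.generating (V := V)
  obtain ⟨a, d, hd⟩ := hC n x
  have hne : {t | ∃ a d : Mat n V, IsDominated a x d ∧ mnorm n a ≤ t ∧ mnorm n d ≤ t}.Nonempty :=
    ⟨_, a, d, hd⟩
  obtain ⟨s, ⟨a, d, h1, ha, hd⟩, hs⟩ := exists_lt_of_csInf_lt hne h
  exact ⟨a, d, h1, ha.trans_lt hs, hd.trans_lt hs⟩

theorem exists_mnorm_le_mul_regNorm (V : Type*) [NormedAddCommGroup V] [NormedSpace ℂ V]
    [StarAddMonoid V] [StarModule ℂ V] [MatrixOrderedOperatorSpace V] [IsRegularizable V] :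
    ∃ k : ℝ, 0 < k ∧ ∀ (n : ℕ) (x : Mat n V), mnorm n x ≤ k * regNorm x := by
  obtain ⟨k, hk, h⟩ := IsRegularizable.mnorm_le (V := V)
  refine ⟨k, hk, fun n x => ?_⟩
  refine le_of_forall_pos_le_add fun ε hε => ?_
  obtain ⟨a, d, h1, ha, hd⟩ := exists_isDominated_of_regNorm_lt
    (show regNorm x < regNorm x + ε / k by have := div_pos hε hk; linarith)
  have h2 := (h n a x d h1).trans (mul_le_mul_of_nonneg_left (max_le ha.le hd.le) hk.le)
  rwa [mul_add, mul_div_cancel₀ _ hk.ne'] at h2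

theorem exists_regNorm_le_mul_mnorm (V : Type*) [NormedAddCommGroup V] [NormedSpace ℂ V]
    [StarAddMonoid V] [StarModule ℂ V] [MatrixOrderedOperatorSpace V] [IsRegularizable V] :
    ∃ C : ℝ, 0 < C ∧ ∀ (n : ℕ) (x : Mat n V), regNorm x ≤ C * mnorm n x := by
  obtain ⟨C, hC, h⟩ := IsRegularizable.generating (V := V)
  refine ⟨C, hC, fun n x => ?_⟩
  obtain ⟨a, d, h1, ha, hd⟩ := h n x
  exact h1.regNorm_le ha hd

theorem eq_zero_of_regNorm (x : Mat n V) (h : regNorm x = 0) : x = 0 := by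
  obtain ⟨k, -, hk⟩ := exists_mnorm_le_mul_regNorm V
  have h1 := hk n x
  rw [h, mul_zero] at h1
  exact eq_zero_of_mnorm n x (le_antisymm h1 (mnorm_nonneg n x))

theorem regNorm_add_le (x y : Mat n V) : regNorm (x + y) ≤ regNorm x + regNorm y := by
  refine le_of_forall_pos_le_add fun ε hε => ?_
  obtain ⟨a, d, h1, ha, hd⟩ := exists_isDominated_of_regNorm_lt
    (show regNorm x < regNorm x + ε / 2 by linarith)
  obtain ⟨a', d', h1', ha', hd'⟩ := exists_isDominated_of_regNorm_lt
    (show regNorm y < regNorm y + ε / 2 by linarith)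
  refine (h1.add h1').regNorm_le ?_ ?_
  · have := mnorm_add_le n a a'
    linarith
  · have := mnorm_add_le n d d'
    linarith

theorem regNorm_bimul_le (α : Matrix (Fin n) (Fin m) ℂ) (x : Mat m V)
    (β : Matrix (Fin m) (Fin n) ℂ) : regNorm (bimul α x β) ≤ ‖α‖ * regNorm x * ‖β‖ := by
  rcases eq_or_ne α 0 with rfl | hα
  · rw [zero_bimul, regNorm_zero]; simp
  rcases eq_or_ne β 0 with rfl | hβ
  · rw [bimul_zero_right, regNorm_zero]; simp
  have hα' := norm_pos_iff.2 hα
  have hβ' := norm_pos_iff.2 hβ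
  have key : ∀ ε : ℝ, 0 < ε → regNorm (bimul α x β) ≤ ‖α‖ * (regNorm x + ε) * ‖β‖ := by
    intro ε hε
    obtain ⟨a, d, h1, ha, hd⟩ := exists_isDominated_of_regNorm_lt
      (show regNorm x < regNorm x + ε by linarith)
    -- The corners `α a αᴴ` and `βᴴ d β` scale like `‖α‖²` and `‖β‖²`; this `s` balances both to
    -- `‖α‖ ‖β‖`.
    have hs : 0 < ‖β‖ / ‖α‖ := by positivity
    refine ((h1.bimul α β).rescale hs).regNorm_le ?_ ?_
    · rw [mnorm_smul, Complex.norm_real, Real.norm_of_nonneg hs.le]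
      have h2 := mnorm_bimul_le m n α a αᴴ
      rw [Matrix.l2_opNorm_conjTranspose] at h2
      calc _ ≤ ‖β‖ / ‖α‖ * (‖α‖ * (regNorm x + ε) * ‖α‖) :=
            mul_le_mul_of_nonneg_left (h2.trans (by gcongr)) hs.le
        _ = _ := by field_simp
    · rw [mnorm_smul, Complex.norm_real, Real.norm_of_nonneg (inv_pos.2 hs).le]
      have h2 := mnorm_bimul_le m n βᴴ d β
      rw [Matrix.l2_opNorm_conjTranspose] at h2
      calc _ ≤ (‖β‖ / ‖α‖)⁻¹ * (‖β‖ * (regNorm x + ε) * ‖β‖) :=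
            mul_le_mul_of_nonneg_left (h2.trans (by gcongr)) (inv_pos.2 hs).le
        _ = _ := by field_simp
  refine le_of_forall_pos_le_add fun ε hε => ?_
  have h1 := key (ε / (‖α‖ * ‖β‖)) (by positivity)
  have h2 : ‖α‖ * (regNorm x + ε / (‖α‖ * ‖β‖)) * ‖β‖ = ‖α‖ * regNorm x * ‖β‖ + ε := by
    field_simp
  rwa [h2] at h1

theorem regNorm_smul_le (c : ℂ) (x : Mat n V) : regNorm (c • x) ≤ ‖c‖ * regNorm x := by
  have h1 := regNorm_bimul_le (c • (1 : Matrix (Fin n) (Fin n) ℂ)) x ((1 : ℂ) • 1)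
  rw [smul_bimul_smul, mul_one, one_bimul_one, one_smul, norm_smul] at h1
  have h2 : ‖(1 : Matrix (Fin n) (Fin n) ℂ)‖ ≤ 1 :=
    norm_le_one_of_conjTranspose_mul_self (by simp)
  have hx := regNorm_nonneg x
  calc _ ≤ ‖c‖ * ‖(1 : Matrix (Fin n) (Fin n) ℂ)‖ * regNorm x
        * ‖(1 : Matrix (Fin n) (Fin n) ℂ)‖ := h1
    _ ≤ ‖c‖ * 1 * regNorm x * 1 := by gcongr
    _ = _ := by ring

theorem regNorm_smul (c : ℂ) (x : Mat n V) : regNorm (c • x) = ‖c‖ * regNorm x := by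
  refine le_antisymm (regNorm_smul_le c x) ?_
  rcases eq_or_ne c 0 with rfl | hc
  · simp [regNorm_zero]
  · have h := regNorm_smul_le c⁻¹ (c • x)
    rw [smul_smul, inv_mul_cancel₀ hc, one_smul, norm_inv] at h
    rwa [le_inv_mul_iff₀ (norm_pos_iff.2 hc)] at h

theorem regNorm_block (x : Mat m V) (y : Mat n V) :
    regNorm (block x 0 0 y) = max (regNorm x) (regNorm y) := by
  refine le_antisymm ?_ (max_le ?_ ?_)
  · refine le_of_forall_pos_le_add fun ε hε => ?_
    set M := max (regNorm x) (regNorm y)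
    obtain ⟨a, d, h1, ha, hd⟩ := exists_isDominated_of_regNorm_lt
      (show regNorm x < M + ε by linarith [le_max_left (regNorm x) (regNorm y)])
    obtain ⟨a', d', h1', ha', hd'⟩ := exists_isDominated_of_regNorm_lt
      (show regNorm y < M + ε by linarith [le_max_right (regNorm x) (regNorm y)])
    refine (h1.directSum h1').regNorm_le ?_ ?_
    · rw [mnorm_block]; exact max_le ha.le ha'.le
    · rw [mnorm_block]; exact max_le hd.le hd'.le
  · have h1 := regNorm_bimul_le (inlScalar m n)ᴴ (block x 0 0 y) (inlScalar m n)
    rw [bimul_inlScalar_block, Matrix.l2_opNorm_conjTranspose] at h1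
    have h2 := norm_inlScalar_le (m := m) (n := n)
    have h3 := regNorm_nonneg (block x 0 0 y)
    calc _ ≤ _ := h1
      _ ≤ 1 * regNorm (block x 0 0 y) * 1 := by gcongr
      _ = _ := by ring
  · have h1 := regNorm_bimul_le (inrScalar m n)ᴴ (block x 0 0 y) (inrScalar m n)
    rw [bimul_inrScalar_block, Matrix.l2_opNorm_conjTranspose] at h1
    have h2 := norm_inrScalar_le (m := m) (n := n)
    have h3 := regNorm_nonneg (block x 0 0 y)
    calc _ ≤ _ := h1
      _ ≤ 1 * regNorm (block x 0 0 y) * 1 := by gcongr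
      _ = _ := by ring

end RegularNorm

/-! ### The matrix regular space -/

section RegularModel

open OperatorSpace MatrixOrdered MatrixOrderedOperatorSpace

/-- A copy of `V`, to carry the regular norms. -/
def RegularModel (V : Type u) : Type u := V

variable (V : Type u) [NormedAddCommGroup V] [NormedSpace ℂ V] [StarAddMonoid V]
  [StarModule ℂ V] [MatrixOrderedOperatorSpace V] [IsRegularizable V]

instance : AddCommGroup (RegularModel V) := inferInstanceAs (AddCommGroup V)

instance : Module ℂ (RegularModel V) := inferInstanceAs (Module ℂ V)

/-- The regular norm on `V` itself. -/
def regularAddGroupNorm : AddGroupNorm (RegularModel V) where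
  toFun v := regNorm (V := V) (Matrix.of fun (_ _ : Fin 1) => v)
  map_zero' := regNorm_zero (V := V) (n := 1)
  add_le' v w := regNorm_add_le (V := V) (Matrix.of fun (_ _ : Fin 1) => v)
    (Matrix.of fun (_ _ : Fin 1) => w)
  neg' v := by
    have h := regNorm_smul (V := V) (-1) (Matrix.of fun (_ _ : Fin 1) => v)
    rw [norm_neg, norm_one, one_mul, neg_one_smul] at h
    exact h
  eq_zero_of_map_eq_zero' v h := by
    have h1 := eq_zero_of_regNorm (V := V) _ h
    exact congrFun (congrFun h1 0) 0

instance : NormedAddCommGroup (RegularModel V) :=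
  (regularAddGroupNorm V).toNormedAddCommGroup

instance : NormedSpace ℂ (RegularModel V) where
  norm_smul_le c v := (regNorm_smul (V := V) c (Matrix.of fun (_ _ : Fin 1) => v)).le

instance : StarAddMonoid (RegularModel V) := inferInstanceAs (StarAddMonoid V)

instance : StarModule ℂ (RegularModel V) := inferInstanceAs (StarModule ℂ V)

instance : MatrixOrdered (RegularModel V) where
  cone n := (cone n : Set (Mat n V))
  cone_isHermitian := cone_isHermitian (V := V)
  cone_zero := cone_zero (V := V)
  cone_add := cone_add (V := V)
  cone_smul := cone_smul (V := V)
  cone_bimul := cone_bimul (V := V)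

instance : OperatorSpace (RegularModel V) where
  mnorm n x := regNorm (V := V) (n := n) x
  mnorm_one _ := rfl
  mnorm_add_le _ x y := regNorm_add_le (V := V) x y
  mnorm_smul _ c x := regNorm_smul (V := V) c x
  eq_zero_of_mnorm _ x h := eq_zero_of_regNorm (V := V) x h
  mnorm_block _ _ x y := regNorm_block (V := V) x y
  mnorm_bimul_le _ _ α x β := regNorm_bimul_le (V := V) α x β

instance : MatrixOrderedOperatorSpace (RegularModel V) where
  mnorm_conjTranspose _ x := regNorm_conjTranspose (V := V) x
  cone_closed n x h := by
    obtain ⟨k, hk, hle⟩ := exists_mnorm_le_mul_regNorm V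
    refine MatrixOrderedOperatorSpace.cone_closed (V := V) n x fun ε hε => ?_
    obtain ⟨y, hy, hlt⟩ := h (ε / k) (div_pos hε hk)
    refine ⟨y, hy, (hle n _).trans_lt ?_⟩
    rw [lt_div_iff₀ hk, mul_comm] at hlt
    exact hlt

/-- The identity map from `V` to its regular model. -/
def toRegularModel : V ≃ₗ[ℂ] RegularModel V := LinearEquiv.refl ℂ V

theorem isCompleteIso_toRegularModel : IsCompleteIso (toRegularModel V) := by
  obtain ⟨k, -, hk⟩ := exists_mnorm_le_mul_regNorm V
  obtain ⟨C, -, hC⟩ := exists_regNorm_le_mul_mnorm V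
  exact ⟨⟨C, fun n x => hC n x⟩, ⟨k, fun n x => hk n x⟩⟩

theorem isCompleteOrderIso_toRegularModel : IsCompleteOrderIso (toRegularModel V) :=
  ⟨fun _ => rfl, fun _ _ => Iff.rfl⟩

/-- Completeness transfers because the two norms on `V` are equivalent. -/
instance [CompleteSpace V] : CompleteSpace (RegularModel V) := by
  obtain ⟨k, hk, hle⟩ := exists_mnorm_le_mul_regNorm V
  obtain ⟨C, hC, hge⟩ := exists_regNorm_le_mul_mnorm V
  have h1 : ∀ v, ‖toRegularModel V v‖ ≤ C * ‖v‖ := fun v => by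
    have := hge 1 (Matrix.of fun (_ _ : Fin 1) => v)
    rwa [mnorm_one] at this
  have h2 : ∀ w, ‖(toRegularModel V).symm w‖ ≤ k * ‖w‖ := fun w => by
    have := hle 1 (Matrix.of fun (_ _ : Fin 1) => (toRegularModel V).symm w)
    rwa [mnorm_one] at this
  refine Metric.complete_of_cauchySeq_tendsto fun u hu => ?_
  have hu' : CauchySeq fun i => (toRegularModel V).symm (u i) :=
    (AddMonoidHomClass.uniformContinuous_of_bound _ k h2).comp_cauchySeq hu
  obtain ⟨v, hv⟩ := cauchySeq_tendsto_of_complete hu'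
  refine ⟨toRegularModel V v, ?_⟩
  have h3 := ((AddMonoidHomClass.continuous_of_bound (toRegularModel V) C h1).tendsto v).comp hv
  simpa [Function.comp_def] using h3

theorem isMatrixRegular_regularModel [CompleteSpace V] : IsMatrixRegular (RegularModel V) where
  complete := inferInstance
  norm_le n v u hv hu h1 h2 := by
    refine le_of_forall_pos_le_add fun ε hε => ?_
    obtain ⟨a, d, h, ha, hd⟩ := exists_isDominated_of_regNorm_lt (V := V) (n := n) (x := u)
      (show regNorm (V := V) (n := n) u < regNorm (V := V) (n := n) u + ε by linarith)
    exact h.regNorm_le_of_le (cone_isHermitian (V := V) n u hu) hv h1 h2 ha.le hd.le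
  exists_dominating n v hv hlt := by
    obtain ⟨a, d, h, ha, hd⟩ := exists_isDominated_of_regNorm_lt (V := V) (n := n) (x := v) hlt
    set c : Mat n V := (1 / 2 : ℂ) • (a + d) with hc
    have hcone : c ∈ cone n := by
      have := cone_smul n (1 / 2) _ (by norm_num) (cone_add _ _ _ h.left_mem h.right_mem)
      simpa [hc] using this
    have hcn : mnorm n c < 1 := by
      rw [hc, mnorm_smul]
      have := mnorm_add_le n a d
      norm_num
      linarith
    -- A positive `c` dominates itself, so its regular norm is at most its original norm, which is
    -- below 1.
    have hdom : IsDominated c c c := by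
      refine IsDominated.of_le (cone_isHermitian n c hcone) (cone_add _ _ _ hcone hcone) ?_
      rw [sub_self]; exact cone_zero n
    exact ⟨c, hcone, (hdom.regNorm_le le_rfl le_rfl).trans_lt hcn, h.add_add_mem hv,
      h.add_sub_mem hv⟩

end RegularModel

/-! ### Conclusion: the two operator system hypotheses -/

theorem isRegularizable_of_isOperatorSystem {V : Type*} [NormedAddCommGroup V] [NormedSpace ℂ V]
    [CompleteSpace V] [StarAddMonoid V] [NormedStarGroup V] [StarModule ℂ V]
    [MatrixOrderedOperatorSpace V] (hV : IsOperatorSystem V)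
    (hdual : IsOperatorSystem (StrongDual ℂ V)) : IsRegularizable V where
  mnorm_le := by
    obtain ⟨k, hk, h⟩ := hV.dominated
    exact ⟨k, hk, fun n a x d hd =>
      (h n x).trans (mul_le_mul_of_nonneg_left hd.numRadius_le hk.le)⟩
  generating := exists_isDominated hdual

end OpSys

end

theorem mainTheorem2 (V : Type u) [NormedAddCommGroup V] [NormedSpace ℂ V] [CompleteSpace V]
    [StarAddMonoid V] [NormedStarGroup V] [StarModule ℂ V] [OpSys.MatrixOrderedOperatorSpace V]
    (hV : OpSys.IsOperatorSystem V) (hVdual : OpSys.IsOperatorSystem (StrongDual ℂ V)) :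
    ∃ (W : Type u) (_ : NormedAddCommGroup W) (_ : NormedSpace ℂ W) (_ : StarAddMonoid W)
      (_ : StarModule ℂ W) (_ : OpSys.MatrixOrderedOperatorSpace W),
      OpSys.IsMatrixRegular W ∧
        ∃ Φ : V ≃ₗ[ℂ] W, OpSys.IsCompleteIso Φ ∧ OpSys.IsCompleteOrderIso Φ := by
  have := OpSys.isRegularizable_of_isOperatorSystem hV hVdual
  exact ⟨OpSys.RegularModel V, inferInstance, inferInstance, inferInstance, inferInstance,
    inferInstance, OpSys.isMatrixRegular_regularModel V, OpSys.toRegularModel V,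
    OpSys.isCompleteIso_toRegularModel V, OpSys.isCompleteOrderIso_toRegularModel V⟩
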